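/- For a probability measure $\eta$ on $\mathbb{R}$ write $F_\eta(x)=\eta((-\infty,x])$, $F_\eta(x-)=\eta((-\infty,x))$ and $F_\eta^{-1}(u)=\inf\{x\in\mathbb{R}:F_\eta(x)\ge u\}$. Let $\mathcal{P}_2(\mathbb{R})$ be the set of probability measures on $\mathbb{R}$ with finite second moment, $\Pi(\mu,\nu)$ the set of couplings of $\mu$ and $\nu$, $W_2^2(\mu,\nu)=\inf_{\pi\in\Pi(\mu,\nu)}\int|y-x|^2\,\pi(dx,dy)$, and $\Pi^{opt}(\mu,\nu)$ the set of couplings that attain this infimum. Write $\eta\le_{cx}\nu$ if $\int\phi\,d\eta\le\int\phi\,d\nu$ for every convex $\phi:\mathbb{R}\to\mathbb{R}$ for which both integrals make sense (infinite values allowed). A martingale coupling between $\eta$ and $\nu$ is a coupling of the form $\eta(dx)k(x,dy)$ with a Markov kernel $k$ such that $\int|y|\,k(x,dy)<\infty$ and $\int y\,k(x,dy)=x$ for all $x$. For $\mu,\nu\in\mathcal{P}_2(\mathbb{R})$ set $$\mathcal{I}_\mu^\nu=\Big\{\eta\in\mathcal{P}_2(\mathbb{R}):\eta\le_{cx}\nu,\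 W_2^2(\mu,\nu)=W_2^2(\mu,\eta)+\int|y|^2\nu(dy)-\int|z|^2\eta(dz)\Big\},$$ and let $\tilde{\mathcal{I}}_\mu^\nu$ be the set of the images of $\mu$ by the maps $x\mapsto\int y\,k(x,dy)$, where $k$ runs over the Markov kernels with $\mu(dx)k(x,dy)\in\Pi^{opt}(\mu,\nu)$. Proposition. Let $\mu,\nu\in\mathcal{P}_2(\mathbb{R})$ and $$\mathcal{T}(x)=\int_0^1F_\nu^{-1}\big(F_\mu(x-)+u[F_\mu(x)-F_\mu(x-)]\big)\,du,$$ an integral that converges for $\mu$-almost every $x$ and defines a $\mu$-a.e. measurable function. Then $\tilde{\mathcal{I}}_\mu^\nu=\{\mathcal{T}\#\mu\}$ and $\mathcal{I}_\mu^\nu=\{\eta\in\mathcal{P}_2(\mathbb{R}):\mathcal{T}\#\mu\le_{cx}\eta\le_{cx}\nu\}$. Moreover, $\Pi^{opt}(\mu,\mathcal{T}\#\mu)=\{(I_1,\mathcal{T})\#\mu\}$, where $I_1$ is the identity map of $\mathbb{R}$, and there is a unique martingale coupling between $\mathcal{T}\#\mu$ and $\nu$, and it is $W_2$-optimal. -/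

import Mathlib

open MeasureTheory ProbabilityTheory Set
open scoped ENNReal

/-- Probability measures with finite second moment. -/
structure IsP2 {E : Type*} [NormedAddCommGroup E] [MeasurableSpace E] (μ : Measure E) : Prop where
  isProb : IsProbabilityMeasure μ
  memLp : MemLp (fun x : E => x) 2 μ

/-- `Π(μ, ν)`: measures on `ℝ × ℝ` with first marginal `μ` and second marginal `ν`. -/
def couplings (μ ν : Measure ℝ) : Set (Measure (ℝ × ℝ)) :=
  {π | π.map Prod.fst = μ ∧ π.map Prod.snd = ν}

/-- The quadratic transport cost `∫ |y - x|² π(dx, dy)`, valued in `[0, ∞]`. -/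
noncomputable def quadCost (π : Measure (ℝ × ℝ)) : ℝ≥0∞ :=
  ∫⁻ p, ENNReal.ofReal (|p.2 - p.1| ^ 2) ∂π

/-- The squared Wasserstein distance `W₂²(μ, ν)`, valued in `[0, ∞]`. -/
noncomputable def W2sq (μ ν : Measure ℝ) : ℝ≥0∞ :=
  ⨅ π ∈ couplings μ ν, quadCost π

/-- `Π^opt(μ, ν)`: the set of `W₂`-optimal couplings. -/
def optCouplings (μ ν : Measure ℝ) : Set (Measure (ℝ × ℝ)) :=
  {π | IsP2 π ∧ π ∈ couplings μ ν ∧ W2sq μ ν = quadCost π}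

/-- The integral of `φ` makes sense: the positive or the negative part has a finite integral. -/
def IntegralMakesSense (φ : ℝ → ℝ) (μ : Measure ℝ) : Prop :=
  ∫⁻ x, ENNReal.ofReal (φ x) ∂μ ≠ ∞ ∨ ∫⁻ x, ENNReal.ofReal (-φ x) ∂μ ≠ ∞

/-- The integral of `φ` in `[-∞, ∞]`, as integral of the positive part minus integral of the
negative part. -/
noncomputable def extIntegral (φ : ℝ → ℝ) (μ : Measure ℝ) : EReal :=
  ((∫⁻ x, ENNReal.ofReal (φ x) ∂μ : ℝ≥0∞) : EReal) -
    ((∫⁻ x, ENNReal.ofReal (-φ x) ∂μ : ℝ≥0∞) : EReal)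

/-- The convex order: `∫ φ dη ≤ ∫ φ dν` for all convex `φ : ℝ → ℝ` such that both integrals make
sense (possibly with infinite values). -/
def ConvexOrderLE (η ν : Measure ℝ) : Prop :=
  ∀ φ : ℝ → ℝ, ConvexOn ℝ univ φ → IntegralMakesSense φ η → IntegralMakesSense φ ν →
    extIntegral φ η ≤ extIntegral φ ν

/-- Martingale Markov kernels: `∫ |y| k(x, dy) < ∞` and `∫ y k(x, dy) = x` for all `x`. -/
def IsMartingaleKernel (k : Kernel ℝ ℝ) : Prop :=
  IsMarkovKernel k ∧ ∀ x, Integrable (fun y : ℝ => y) (k x) ∧ ∫ y, y ∂(k x) = x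

/-- Martingale couplings between `η` and `ν`: the couplings of the form `η(dx) k(x, dy)` with `k` a
martingale Markov kernel. -/
def martingaleCouplings (η ν : Measure ℝ) : Set (Measure (ℝ × ℝ)) :=
  {π | π ∈ couplings η ν ∧ ∃ k : Kernel ℝ ℝ, IsMartingaleKernel k ∧ π = η ⊗ₘ k}

/-- The set `𝓘_μ^ν` of the `η ∈ 𝓟₂(ℝ)` with `η ≤_cx ν` and
`W₂²(μ, ν) = W₂²(μ, η) + ∫ y² dν - ∫ z² dη`. -/
def interSet (μ ν : Measure ℝ) : Set (Measure ℝ) :=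
  {η | IsP2 η ∧ ConvexOrderLE η ν ∧
    (W2sq μ ν).toReal = (W2sq μ η).toReal + ∫ y, |y| ^ 2 ∂ν - ∫ z, |z| ^ 2 ∂η}

/-- The set of barycentric images: the images of `μ` by `x ↦ ∫ y k(x, dy)`, where `k` is a Markov
kernel such that `μ(dx) k(x, dy)` is a `W₂`-optimal coupling between `μ` and `ν`. -/
def barySet (μ ν : Measure ℝ) : Set (Measure ℝ) :=
  {η | ∃ k : Kernel ℝ ℝ, IsMarkovKernel k ∧ μ ⊗ₘ k ∈ optCouplings μ ν ∧
    η = μ.map (fun x => ∫ y, y ∂(k x))}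

/-- The quantile function `F_ν⁻¹(u) = inf {x | F_ν(x) ≥ u}` (only meaningful for `0 < u < 1`). -/
noncomputable def quantile (ν : Measure ℝ) (u : ℝ) : ℝ :=
  sInf {x : ℝ | u ≤ cdf ν x}

/-- The function `u ↦ F_ν⁻¹(F_μ(x-) + u [F_μ(x) - F_μ(x-)])`. -/
noncomputable def jumpQuantile (μ ν : Measure ℝ) (x u : ℝ) : ℝ :=
  quantile ν
    (Function.leftLim (cdf μ) x + u * (cdf μ x - Function.leftLim (cdf μ) x))

/-- The map `𝓣(x) = ∫₀¹ F_ν⁻¹(F_μ(x-) + u [F_μ(x) - F_μ(x-)]) du`. -/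
noncomputable def baryMap (μ ν : Measure ℝ) (x : ℝ) : ℝ :=
  ∫ u in (0 : ℝ)..1, jumpQuantile μ ν x u

/-! Expanding the square, the cost of a coupling of `μ` and `η` depends on it only through `∫ xy`,
and a layer-cake formula writes `∫ xy` as an integral over `s` of the upper integrals `∫_{x > s} y`.
At each level, for every real `t`, `∫_{x > s} y ≤ t μ(s, ∞) + ∫ (y - t)⁺ dη`, with equality exactly
when the coupling splits at `(s, t)` (`upper_setIntegral_eq_iff`). The comonotone coupling splits at
`t = F_η⁻¹(F_μ(s))`, and the right side increases in the convex order. Hence the maximum of `∫ xy`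
over couplings increases with `η` (`integral_mul_le_comonotone`). Equality of maxima forces equality
of all upper integrals (`upper_setIntegral_eq_of_integral_mul_eq`). For equal second marginals this
gives uniqueness of the optimal coupling; in general it gives equality of the barycentric maps `𝓣`.

The rest follows. The identity defining `interSet` says that `η` and `ν` have the same maximal `∫
xy`. So `𝓣` is a.e. the barycentric map for `η` as well, and Jensen gives `𝓣#μ ≤_cx η`; conversely
any `η` between `𝓣#μ` and `ν` is sandwiched, because both ends have maximum `∫ x 𝓣(x) dμ`. A
martingale kernel from `𝓣#μ` to `ν`, evaluated at `𝓣(x)`, gives a coupling of `μ` and `ν` with this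
same value of `∫ xy`, hence the comonotone one; this is uniqueness. Optimality holds because `𝓣` is
nondecreasing on a set of full measure, so it preserves comonotonicity. -/

/-! ### Quantile functions. -/

open Filter Topology in
theorem quantile_le_iff (ν : Measure ℝ) {u : ℝ} (hu : u ∈ Ioo (0 : ℝ) 1) (x : ℝ) :
    quantile ν u ≤ x ↔ u ≤ cdf ν x := by
  have hne : {x : ℝ | u ≤ cdf ν x}.Nonempty := by
    obtain ⟨y, hy⟩ := ((tendsto_cdf_atTop ν).eventually (lt_mem_nhds hu.2)).exists
    exact ⟨y, hy.le⟩
  have hbd : BddBelow {x : ℝ | u ≤ cdf ν x} := by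
    obtain ⟨y, hy⟩ := ((tendsto_cdf_atBot ν).eventually (gt_mem_nhds hu.1)).exists
    refine ⟨y, fun z hz => ?_⟩
    by_contra! h
    exact absurd ((hz : u ≤ cdf ν z).trans (monotone_cdf ν h.le)) (not_le.2 hy)
  refine ⟨fun h => ?_, fun h => csInf_le hbd h⟩
  refine le_trans ?_ (monotone_cdf ν h)
  -- Right-continuity of the distribution function makes the infimum attained.
  have hc : Tendsto (cdf ν) (𝓝[>] (quantile ν u)) (𝓝 (cdf ν (quantile ν u))) :=
    ((cdf ν).right_continuous _).tendsto.mono_left (nhdsWithin_mono _ Ioi_subset_Ici_self)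
  refine ge_of_tendsto hc ?_
  filter_upwards [self_mem_nhdsWithin] with y hy
  obtain ⟨z, hz, hzy⟩ := exists_lt_of_csInf_lt hne hy
  exact (hz : u ≤ cdf ν z).trans (monotone_cdf ν hzy.le)

theorem quantile_monotoneOn (ν : Measure ℝ) : MonotoneOn (quantile ν) (Ioo 0 1) := by
  intro u hu v hv huv
  rw [quantile_le_iff ν hu]
  exact huv.trans ((quantile_le_iff ν hv _).1 le_rfl)

theorem quantile_of_nonpos (ν : Measure ℝ) {u : ℝ} (hu : u ≤ 0) : quantile ν u = 0 := by
  have : {x : ℝ | u ≤ cdf ν x} = univ := by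
    ext x; simpa using hu.trans (cdf_nonneg ν x)
  rw [quantile, this, Real.sInf_univ]

theorem quantile_of_one_lt (ν : Measure ℝ) {u : ℝ} (hu : 1 < u) : quantile ν u = 0 := by
  have : {x : ℝ | u ≤ cdf ν x} = ∅ := by
    ext x; simpa using (cdf_le_one ν x).trans_lt hu
  rw [quantile, this, Real.sInf_empty]

theorem measurable_quantile (ν : Measure ℝ) : Measurable (quantile ν) := by
  refine measurable_of_Iic fun x => ?_
  -- Outside `(0, 1]` the infimum is the default value `0`. The level `1` is isolated because its
  -- defining set may or may not be empty.
  have h : quantile ν ⁻¹' Iic x = (Ioo 0 1 ∩ Iic (cdf ν x)) ∪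
      ((Iic 0 ∪ Ioi 1) ∩ {_u | (0 : ℝ) ≤ x}) ∪ ({1} ∩ {_u | quantile ν 1 ≤ x}) := by
    ext u
    simp only [mem_preimage, mem_Iic, mem_union, mem_inter_iff, mem_Ioi, mem_ofPred_eq,
      mem_singleton_iff]
    rcases le_or_gt u 0 with h0 | h0
    · have h1 : ¬ (u = 1) := by linarith
      have h2 : ¬ (1 < u) := by linarith
      simp [quantile_of_nonpos ν h0, h0, h1, not_lt.2 h0]
    rcases lt_trichotomy u 1 with h1 | rfl | h1
    · simp [quantile_le_iff ν ⟨h0, h1⟩, h0, h1, h1.ne, not_le.2 h0, not_lt.2 h1.le]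
    · simp
    · simp [quantile_of_one_lt ν h1, h1, h1.ne', not_lt.2 h1.le]
  rw [h]
  exact ((measurableSet_Ioo.inter measurableSet_Iic).union
    ((measurableSet_Iic.union measurableSet_Ioi).inter (MeasurableSet.const _))).union
    ((measurableSet_singleton _).inter (MeasurableSet.const _))

/-! ### The distributional transform. -/

/-- The point of the jump interval `[F_μ(x-), F_μ(x)]` with relative position `u`. -/
noncomputable def jumpLevel (μ : Measure ℝ) (x u : ℝ) : ℝ :=
  Function.leftLim (cdf μ) x + u * (cdf μ x - Function.leftLim (cdf μ) x)

theorem measurable_jumpLevel (μ : Measure ℝ) :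
    Measurable fun p : ℝ × ℝ => jumpLevel μ p.1 p.2 := by
  have h1 : Measurable (cdf μ) := (monotone_cdf μ).measurable
  have h2 : Measurable (Function.leftLim (cdf μ)) := (monotone_cdf μ).leftLim.measurable
  unfold jumpLevel
  fun_prop

theorem measurable_jumpQuantile (μ ν : Measure ℝ) :
    Measurable fun p : ℝ × ℝ => jumpQuantile μ ν p.1 p.2 :=
  (measurable_quantile ν).comp (measurable_jumpLevel μ)

theorem measurable_jumpQuantile_right (μ ν : Measure ℝ) (x : ℝ) :
    Measurable (jumpQuantile μ ν x) :=
  Measurable.of_uncurry_left (f := jumpQuantile μ ν) (measurable_jumpQuantile μ ν)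

theorem jumpLevel_le_cdf (μ : Measure ℝ) {x s u : ℝ} (hu : u ∈ Ioc (0 : ℝ) 1) (hxs : x ≤ s) :
    jumpLevel μ x u ≤ cdf μ s := by
  have h := (monotone_cdf μ).leftLim_le (le_refl x)
  have h' := monotone_cdf μ hxs
  unfold jumpLevel
  nlinarith [hu.1, hu.2]

theorem leftLim_le_jumpLevel (μ : Measure ℝ) {x u : ℝ} (hu : u ∈ Ioc (0 : ℝ) 1) :
    Function.leftLim (cdf μ) x ≤ jumpLevel μ x u := by
  have h := (monotone_cdf μ).leftLim_le (le_refl x)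
  unfold jumpLevel
  nlinarith [hu.1, hu.2]

theorem cdf_le_jumpLevel (μ : Measure ℝ) {x s u : ℝ} (hu : u ∈ Ioc (0 : ℝ) 1) (hsx : s < x) :
    cdf μ s ≤ jumpLevel μ x u :=
  ((monotone_cdf μ).le_leftLim hsx).trans (leftLim_le_jumpLevel μ hu)

/-- The uniform distribution on `(0, 1]`. -/
noncomputable def uniformUnit : Measure ℝ := volume.restrict (Ioc 0 1)

instance : IsProbabilityMeasure uniformUnit := ⟨by simp [uniformUnit]⟩

theorem ae_mem_uniformUnit : ∀ᵐ u ∂uniformUnit, u ∈ Ioc (0 : ℝ) 1 :=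
  ae_restrict_mem measurableSet_Ioc

theorem uniformUnit_Iic {v : ℝ} (h1 : v ≤ 1) :
    uniformUnit (Iic v) = ENNReal.ofReal v := by
  rw [uniformUnit, Measure.restrict_apply measurableSet_Iic]
  have : Iic v ∩ Ioc 0 1 = Ioc 0 v := by ext; simp; grind
  rw [this, Real.volume_Ioc, sub_zero]

theorem ae_snd_mem_uniformUnit (μ : Measure ℝ) [IsProbabilityMeasure μ] :
    ∀ᵐ p ∂(μ.prod uniformUnit), p.2 ∈ Ioc (0 : ℝ) 1 :=
  Measure.quasiMeasurePreserving_snd.ae ae_mem_uniformUnit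

theorem measure_Iio_eq_leftLim_cdf (μ : Measure ℝ) [IsProbabilityMeasure μ] (x : ℝ) :
    μ (Iio x) = ENNReal.ofReal (Function.leftLim (cdf μ) x) := by
  conv_lhs => rw [← measure_cdf μ]
  rw [StieltjesFunction.measure_Iio _ (tendsto_cdf_atBot μ), sub_zero]

theorem measure_singleton_eq_jump (μ : Measure ℝ) [IsProbabilityMeasure μ] (x : ℝ) :
    μ {x} = ENNReal.ofReal (cdf μ x - Function.leftLim (cdf μ) x) := by
  conv_lhs => rw [← measure_cdf μ]
  rw [StieltjesFunction.measure_singleton]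

/-- Two-sided bound for the distribution function of the distributional transform of `μ`. -/
theorem measure_jumpLevel_lt_le_and_le (μ : Measure ℝ) [IsProbabilityMeasure μ] {v : ℝ}
    (hv : v ∈ Ioo (0 : ℝ) 1) :
    (μ.prod uniformUnit) {p | jumpLevel μ p.1 p.2 < v} ≤ ENNReal.ofReal v ∧
      ENNReal.ofReal v ≤ (μ.prod uniformUnit) {p | jumpLevel μ p.1 p.2 ≤ v} := by
  set x := quantile μ v with hx
  set a := Function.leftLim (cdf μ) x with ha
  set d := cdf μ x - a with hd
  have hvx : v ≤ cdf μ x := (quantile_le_iff μ hv x).1 le_rfl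
  have hxv : a ≤ v := by
    refine le_of_tendsto ((monotone_cdf μ).tendsto_leftLim x) ?_
    filter_upwards [self_mem_nhdsWithin] with y hy
    by_contra! h
    exact absurd ((quantile_le_iff μ hv y).2 h.le) (not_le.2 hy)
  have ha0 : 0 ≤ a := (cdf_nonneg μ (x - 1)).trans ((monotone_cdf μ).le_leftLim (by linarith))
  have hd0 : 0 ≤ d := by linarith
  -- The mass is `a + d * ((v - a) / d) = v` if there is an atom at the quantile `x`, and `a = v`
  -- otherwise. Up to null sets, this event lies between the two in the statement.
  have key : (μ.prod uniformUnit) (Iio x ×ˢ univ ∪ {x} ×ˢ {u | a + u * d ≤ v})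
      = ENNReal.ofReal v := by
    have hm : MeasurableSet {u : ℝ | a + u * d ≤ v} := measurableSet_le (by fun_prop) (by fun_prop)
    rw [measure_union (by
        rw [Set.disjoint_left]
        rintro ⟨y, u⟩ h h'
        simp only [mem_prod, mem_Iio, mem_singleton_iff] at h h'
        exact absurd h'.1 h.1.ne) ((measurableSet_singleton x).prod hm),
      Measure.prod_prod, Measure.prod_prod, measure_univ, mul_one, measure_Iio_eq_leftLim_cdf,
      measure_singleton_eq_jump, ← ha, ← hd]
    rcases hd0.eq_or_lt with h | h
    · rw [← h]
      simp only [ENNReal.ofReal_zero, zero_mul, add_zero]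
      congr 1; linarith
    · have : {u : ℝ | a + u * d ≤ v} = Iic ((v - a) / d) := by
        ext u
        simp only [mem_ofPred_eq, mem_Iic, le_div_iff₀ h]
        constructor <;> intro <;> linarith
      rw [this, uniformUnit_Iic (by rw [div_le_one h]; linarith),
        ← ENNReal.ofReal_mul hd0, ← ENNReal.ofReal_add ha0 (by
          rw [mul_div_cancel₀ _ h.ne']; linarith), mul_div_cancel₀ _ h.ne']
      congr 1; ring
  rw [← key]
  constructor
  · refine measure_mono_ae ?_
    filter_upwards [ae_snd_mem_uniformUnit μ] with p hp h
    rcases lt_trichotomy p.1 x with h1 | h1 | h1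
    · exact Or.inl ⟨h1, trivial⟩
    · refine Or.inr ⟨h1, ?_⟩
      have : jumpLevel μ p.1 p.2 < v := h
      rw [h1] at this
      exact this.le
    · exact absurd (h : jumpLevel μ p.1 p.2 < v) (not_lt.2 (hvx.trans (cdf_le_jumpLevel μ hp h1)))
  · refine measure_mono_ae ?_
    filter_upwards [ae_snd_mem_uniformUnit μ] with p hp h
    rcases h with h | h
    · change jumpLevel μ p.1 p.2 ≤ v
      exact ((jumpLevel_le_cdf μ hp le_rfl).trans ((monotone_cdf μ).le_leftLim h.1)).trans hxv
    · change jumpLevel μ p.1 p.2 ≤ v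
      rw [show p.1 = x from h.1]
      exact h.2

/-- Spreading each atom uniformly over its jump interval makes the level uniform. The upper bound
for `≤ v` comes from the bound for `< w` as `w` decreases to `v`. -/
theorem map_jumpLevel_eq_uniformUnit (μ : Measure ℝ) [IsProbabilityMeasure μ] :
    (μ.prod uniformUnit).map (fun p => jumpLevel μ p.1 p.2) = uniformUnit := by
  have hm := measurable_jumpLevel μ
  have : IsProbabilityMeasure ((μ.prod uniformUnit).map (fun p => jumpLevel μ p.1 p.2)) :=
    Measure.isProbabilityMeasure_map hm.aemeasurable
  refine Measure.ext_of_Iic _ _ fun v => ?_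
  rw [Measure.map_apply hm measurableSet_Iic]
  have mid : ∀ v ∈ Ioo (0 : ℝ) 1,
      (μ.prod uniformUnit) ((fun p => jumpLevel μ p.1 p.2) ⁻¹' Iic v) = ENNReal.ofReal v := by
    intro v hv
    refine le_antisymm ?_ (measure_jumpLevel_lt_le_and_le μ hv).2
    have hc : Filter.Tendsto ENNReal.ofReal (nhdsWithin v (Ioi v)) (nhds (ENNReal.ofReal v)) :=
      ENNReal.continuous_ofReal.continuousWithinAt
    refine ge_of_tendsto hc ?_
    filter_upwards [Ioo_mem_nhdsGT hv.2] with w hw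
    refine le_trans (measure_mono fun p hp => ?_)
      (measure_jumpLevel_lt_le_and_le μ ⟨hv.1.trans hw.1, hw.2⟩).1
    exact lt_of_le_of_lt hp hw.1
  rcases le_or_gt v 0 with h0 | h0
  · have h1 : uniformUnit (Iic v) = 0 := by
      refine le_antisymm ((measure_mono (Iic_subset_Iic.2 h0)).trans ?_) zero_le
      rw [uniformUnit_Iic zero_le_one, ENNReal.ofReal_zero]
    rw [h1]
    refine le_antisymm ?_ zero_le
    have hc : Filter.Tendsto ENNReal.ofReal (nhdsWithin 0 (Ioi 0)) (nhds (ENNReal.ofReal 0)) :=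
      ENNReal.continuous_ofReal.continuousWithinAt
    rw [ENNReal.ofReal_zero] at hc
    refine ge_of_tendsto hc ?_
    filter_upwards [Ioo_mem_nhdsGT (zero_lt_one' ℝ)] with w hw
    rw [← mid w hw]
    exact measure_mono (preimage_mono (Iic_subset_Iic.2 (h0.trans hw.1.le)))
  rcases lt_or_ge v 1 with h1 | h1
  · rw [mid v ⟨h0, h1⟩, uniformUnit_Iic h1.le]
  · have h2 : uniformUnit (Iic v) = 1 := by
      refine le_antisymm prob_le_one ?_
      refine le_trans ?_ (measure_mono (Iic_subset_Iic.2 h1))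
      rw [uniformUnit_Iic le_rfl, ENNReal.ofReal_one]
    rw [h2]
    refine (prob_compl_eq_zero_iff (hm measurableSet_Iic)).1 ?_
    refine measure_eq_zero_iff_ae_notMem.2 ?_
    filter_upwards [ae_snd_mem_uniformUnit μ] with p hp h
    exact h ((jumpLevel_le_cdf μ hp le_rfl).trans ((cdf_le_one μ _).trans h1))

theorem ae_uniformUnit_mem_Ioo : ∀ᵐ u ∂uniformUnit, u ∈ Ioo (0 : ℝ) 1 := by
  have h : ∀ᵐ u ∂uniformUnit, u ≠ 1 := by
    exact ae_restrict_of_ae (Measure.ae_ne volume 1)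
  filter_upwards [ae_mem_uniformUnit, h] with u hu h1
  exact ⟨hu.1, lt_of_le_of_ne hu.2 h1⟩

theorem ae_jumpLevel_mem_Ioo (μ : Measure ℝ) [IsProbabilityMeasure μ] :
    ∀ᵐ p ∂(μ.prod uniformUnit), jumpLevel μ p.1 p.2 ∈ Ioo (0 : ℝ) 1 := by
  have h := ae_uniformUnit_mem_Ioo
  rw [← map_jumpLevel_eq_uniformUnit μ] at h
  exact ae_of_ae_map (measurable_jumpLevel μ).aemeasurable h

theorem map_quantile_uniformUnit (ν : Measure ℝ) [IsProbabilityMeasure ν] :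
    uniformUnit.map (quantile ν) = ν := by
  have : IsProbabilityMeasure (uniformUnit.map (quantile ν)) :=
    Measure.isProbabilityMeasure_map (measurable_quantile ν).aemeasurable
  refine Measure.ext_of_Iic _ _ fun t => ?_
  rw [Measure.map_apply (measurable_quantile ν) measurableSet_Iic, ← ofReal_cdf,
    ← uniformUnit_Iic (cdf_le_one ν t)]
  refine measure_congr ?_
  filter_upwards [ae_uniformUnit_mem_Ioo] with u hu
  exact propext (quantile_le_iff ν hu t)

/-! ### The comonotone coupling and its barycenters. -/

/-- The kernel whose value at `x` is the law of `jumpQuantile μ ν x` under the uniform law. -/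
noncomputable def quantileKernel (μ ν : Measure ℝ) : Kernel ℝ ℝ where
  toFun x := uniformUnit.map (jumpQuantile μ ν x)
  measurable' := by
    refine Measure.measurable_of_measurable_coe _ fun s hs => ?_
    simp_rw [Measure.map_apply (measurable_jumpQuantile_right μ ν _) hs]
    exact measurable_measure_prodMk_left (measurable_jumpQuantile μ ν hs)

theorem quantileKernel_apply (μ ν : Measure ℝ) (x : ℝ) :
    quantileKernel μ ν x = uniformUnit.map (jumpQuantile μ ν x) := rfl

instance (μ ν : Measure ℝ) : IsMarkovKernel (quantileKernel μ ν) :=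
  ⟨fun x => Measure.isProbabilityMeasure_map (measurable_jumpQuantile_right μ ν x).aemeasurable⟩

/-- The comonotone coupling of `μ` and `ν`. -/
noncomputable def comonotoneCoupling (μ ν : Measure ℝ) : Measure (ℝ × ℝ) :=
  (μ.prod uniformUnit).map fun p => (p.1, jumpQuantile μ ν p.1 p.2)

theorem measurable_prodMk_jumpQuantile (μ ν : Measure ℝ) :
    Measurable fun p : ℝ × ℝ => (p.1, jumpQuantile μ ν p.1 p.2) :=
  measurable_fst.prodMk (measurable_jumpQuantile μ ν)

theorem compProd_quantileKernel (μ ν : Measure ℝ) [IsProbabilityMeasure μ] :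
    μ ⊗ₘ quantileKernel μ ν = comonotoneCoupling μ ν := by
  ext s hs
  rw [Measure.compProd_apply hs, comonotoneCoupling,
    Measure.map_apply (measurable_prodMk_jumpQuantile μ ν) hs,
    Measure.prod_apply (measurable_prodMk_jumpQuantile μ ν hs)]
  refine lintegral_congr fun x => ?_
  rw [quantileKernel_apply, Measure.map_apply (measurable_jumpQuantile_right μ ν x)
    (measurable_prodMk_left hs)]
  rfl

theorem comonotoneCoupling_mem (μ ν : Measure ℝ) [IsProbabilityMeasure μ]
    [IsProbabilityMeasure ν] : comonotoneCoupling μ ν ∈ couplings μ ν := by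
  constructor
  · rw [comonotoneCoupling, Measure.map_map measurable_fst (measurable_prodMk_jumpQuantile μ ν)]
    exact Measure.fst_prod
  · rw [comonotoneCoupling, Measure.map_map measurable_snd (measurable_prodMk_jumpQuantile μ ν)]
    have : (Prod.snd ∘ fun p : ℝ × ℝ => (p.1, jumpQuantile μ ν p.1 p.2))
        = quantile ν ∘ fun p => jumpLevel μ p.1 p.2 := rfl
    rw [this, ← Measure.map_map (measurable_quantile ν) (measurable_jumpLevel μ),
      map_jumpLevel_eq_uniformUnit, map_quantile_uniformUnit]

theorem baryMap_eq_integral_quantileKernel (μ ν : Measure ℝ) (x : ℝ) :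
    baryMap μ ν x = ∫ y, y ∂(quantileKernel μ ν x) := by
  rw [quantileKernel_apply, integral_map (measurable_jumpQuantile_right μ ν x).aemeasurable
    measurable_id'.aestronglyMeasurable, baryMap, intervalIntegral.integral_of_le zero_le_one]
  rfl

theorem measurable_baryMap (μ ν : Measure ℝ) : Measurable (baryMap μ ν) := by
  have h : baryMap μ ν = fun x => ∫ u, jumpQuantile μ ν x u ∂uniformUnit := by
    ext x
    rw [baryMap, intervalIntegral.integral_of_le zero_le_one]
    rfl
  rw [h]
  exact ((measurable_jumpQuantile μ ν).stronglyMeasurable.integral_prod_right).measurable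

/-! ### Couplings, integrability and the convex order. -/

theorem isProbabilityMeasure_of_mem_couplings {μ ν : Measure ℝ} [IsProbabilityMeasure μ]
    {π : Measure (ℝ × ℝ)} (hπ : π ∈ couplings μ ν) : IsProbabilityMeasure π := by
  refine ⟨?_⟩
  have h : (π.map Prod.fst) univ = 1 := by rw [hπ.1]; exact measure_univ
  rwa [Measure.map_apply measurable_fst MeasurableSet.univ, preimage_univ] at h

theorem IsP2.integrable_id {μ : Measure ℝ} (hμ : IsP2 μ) : Integrable (fun x : ℝ => x) μ :=
  have := hμ.isProb
  hμ.memLp.integrable one_le_two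

theorem IsP2.integrable_sq {μ : Measure ℝ} (hμ : IsP2 μ) : Integrable (fun x : ℝ => x ^ 2) μ :=
  hμ.memLp.integrable_sq

theorem isP2_of_integrable_sq {μ : Measure ℝ} [h : IsProbabilityMeasure μ]
    (hμ : Integrable (fun x : ℝ => x ^ 2) μ) : IsP2 μ :=
  ⟨h, (memLp_two_iff_integrable_sq measurable_id'.aestronglyMeasurable).2 hμ⟩

theorem measurePreserving_fst_of_mem {μ ν : Measure ℝ} {π : Measure (ℝ × ℝ)}
    (hπ : π ∈ couplings μ ν) : MeasurePreserving Prod.fst π μ := ⟨measurable_fst, hπ.1⟩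

theorem measurePreserving_snd_of_mem {μ ν : Measure ℝ} {π : Measure (ℝ × ℝ)}
    (hπ : π ∈ couplings μ ν) : MeasurePreserving Prod.snd π ν := ⟨measurable_snd, hπ.2⟩

theorem integrable_comp_of_measurePreserving {α : Type*} [MeasurableSpace α] {ρ : Measure α}
    {ν : Measure ℝ} {g : α → ℝ} (hg : MeasurePreserving g ρ ν) {f : ℝ → ℝ} (hf : Integrable f ν) :
    Integrable (fun p => f (g p)) ρ :=
  (hg.integrable_comp hf.aestronglyMeasurable).2 hf

theorem integral_comp_of_measurePreserving {α : Type*} [MeasurableSpace α] {ρ : Measure α}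
    {ν : Measure ℝ} {g : α → ℝ} (hg : MeasurePreserving g ρ ν) {f : ℝ → ℝ}
    (hf : AEStronglyMeasurable f ν) : ∫ p, f (g p) ∂ρ = ∫ x, f x ∂ν := by
  have h := hg.map_eq
  rw [← h, integral_map hg.measurable.aemeasurable (by rwa [h])]

theorem extIntegral_eq_integral {φ : ℝ → ℝ} {μ : Measure ℝ} (h : Integrable φ μ) :
    extIntegral φ μ = ((∫ x, φ x ∂μ : ℝ) : EReal) := by
  have h1 : ∫⁻ x, ENNReal.ofReal (φ x) ∂μ ≠ ∞ := h.lintegral_lt_top.ne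
  have h2 : ∫⁻ x, ENNReal.ofReal (-φ x) ∂μ ≠ ∞ := h.neg.lintegral_lt_top.ne
  rw [integral_eq_lintegral_pos_part_sub_lintegral_neg_part h, extIntegral, EReal.coe_sub,
    EReal.coe_ennreal_toReal h1, EReal.coe_ennreal_toReal h2]

theorem ConvexOrderLE.integral_le {η ν : Measure ℝ} (h : ConvexOrderLE η ν) {φ : ℝ → ℝ}
    (hφ : ConvexOn ℝ univ φ) (h1 : Integrable φ η) (h2 : Integrable φ ν) :
    ∫ x, φ x ∂η ≤ ∫ x, φ x ∂ν := by
  have := h φ hφ (Or.inl h1.lintegral_lt_top.ne) (Or.inl h2.lintegral_lt_top.ne)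
  rwa [extIntegral_eq_integral h1, extIntegral_eq_integral h2, EReal.coe_le_coe_iff] at this

theorem convexOrderLE_refl (ν : Measure ℝ) : ConvexOrderLE ν ν := fun _ _ _ _ => le_rfl

theorem ConvexOrderLE.integral_id_eq {η ν : Measure ℝ} (h : ConvexOrderLE η ν) (hη : IsP2 η)
    (hν : IsP2 ν) : ∫ x, x ∂η = ∫ x, x ∂ν := by
  refine le_antisymm (h.integral_le (convexOn_id convex_univ) hη.integrable_id
    hν.integrable_id) ?_
  have := h.integral_le (φ := fun x => -x) (concaveOn_id convex_univ).neg hη.integrable_id.neg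
    hν.integrable_id.neg
  rw [integral_neg, integral_neg] at this
  linarith

theorem ConvexOrderLE.integral_posPart_le {η ν : Measure ℝ} (h : ConvexOrderLE η ν) (hη : IsP2 η)
    (hν : IsP2 ν) (t : ℝ) : ∫ y, max (y - t) 0 ∂η ≤ ∫ y, max (y - t) 0 ∂ν := by
  have := hη.isProb
  have := hν.isProb
  refine h.integral_le ?_ (hη.integrable_id.sub (integrable_const t)).pos_part
    (hν.integrable_id.sub (integrable_const t)).pos_part
  exact ((convexOn_id convex_univ).sub (concaveOn_const t convex_univ)).sup
    (convexOn_const 0 convex_univ)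

theorem continuous_of_convexOn_univ {φ : ℝ → ℝ} (hφ : ConvexOn ℝ univ φ) : Continuous φ :=
  continuousOn_univ.1 (hφ.continuousOn isOpen_univ)

/-- Supplies an integrable lower bound under any measure with a mean, so that only the positive part
of `φ` can have infinite integral. -/
theorem exists_affine_le_of_convexOn_univ {φ : ℝ → ℝ} (hφ : ConvexOn ℝ univ φ) :
    ∃ a c : ℝ, ∀ x, a * x + c ≤ φ x := by
  obtain ⟨a, c, h⟩ := hφ.exists_affine_le_real isClosed_univ
    (continuous_of_convexOn_univ hφ).continuousOn.lowerSemicontinuousOn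
  exact ⟨a, c, fun x => h x (mem_univ x)⟩

/-! ### Barycenters of a disintegration and Jensen's inequality. -/

section Barycenter

theorem measurable_barycenter {k : Kernel ℝ ℝ} : Measurable fun x => ∫ y, y ∂(k x) :=
  (StronglyMeasurable.integral_kernel (f := fun y : ℝ => y)
    measurable_id'.stronglyMeasurable).measurable

variable {μ ν : Measure ℝ} [IsProbabilityMeasure μ] {k : Kernel ℝ ℝ} [IsMarkovKernel k]

theorem ae_integrable_of_compProd_mem (hπ : μ ⊗ₘ k ∈ couplings μ ν) {f : ℝ → ℝ}
    (hf : Integrable f ν) : ∀ᵐ x ∂μ, Integrable f (k x) := by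
  have h := integrable_comp_of_measurePreserving (measurePreserving_snd_of_mem hπ) hf
  exact ((Measure.integrable_compProd_iff h.aestronglyMeasurable).1 h).1

theorem integrable_integral_of_compProd {f : ℝ × ℝ → ℝ} (hf : Integrable f (μ ⊗ₘ k)) :
    Integrable (fun x => ∫ y, f (x, y) ∂(k x)) μ := by
  simpa using MeasureTheory.Integrable.integral_compProd (κ := Kernel.const Unit μ)
    (η := Kernel.prodMkLeft Unit k) (a := ()) hf

theorem integrable_integral_of_compProd_mem (hπ : μ ⊗ₘ k ∈ couplings μ ν) {f : ℝ → ℝ}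
    (hf : Integrable f ν) : Integrable (fun x => ∫ y, f y ∂(k x)) μ :=
  integrable_integral_of_compProd
    (integrable_comp_of_measurePreserving (measurePreserving_snd_of_mem hπ) hf)

theorem integral_integral_of_compProd_mem (hπ : μ ⊗ₘ k ∈ couplings μ ν) {f : ℝ → ℝ}
    (hf : Integrable f ν) : ∫ x, ∫ y, f y ∂(k x) ∂μ = ∫ y, f y ∂ν := by
  rw [← integral_comp_of_measurePreserving (measurePreserving_snd_of_mem hπ)
    hf.aestronglyMeasurable, Measure.integral_compProd
    (integrable_comp_of_measurePreserving (measurePreserving_snd_of_mem hπ) hf)]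

/-- Jensen's inequality for the barycenters of a disintegration. -/
theorem convex_barycenter_le (hπ : μ ⊗ₘ k ∈ couplings μ ν) (hν : Integrable (fun y : ℝ => y) ν)
    {φ : ℝ → ℝ} (hφ : ConvexOn ℝ univ φ) (hφν : Integrable φ ν) :
    Integrable (fun x => φ (∫ y, y ∂(k x))) μ ∧
      ∫ x, φ (∫ y, y ∂(k x)) ∂μ ≤ ∫ y, φ y ∂ν := by
  have hc := continuous_of_convexOn_univ hφ
  have hle : ∀ᵐ x ∂μ, φ (∫ y, y ∂(k x)) ≤ ∫ y, φ y ∂(k x) := by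
    filter_upwards [ae_integrable_of_compProd_mem hπ hν,
      ae_integrable_of_compProd_mem hπ hφν] with x h1 h2
    exact hφ.map_integral_le hc.continuousOn isClosed_univ (by simp) h1 h2
  obtain ⟨a, c, hac⟩ := exists_affine_le_of_convexOn_univ hφ
  have hi1 := integrable_integral_of_compProd_mem hπ hν
  have hi2 := integrable_integral_of_compProd_mem hπ hφν
  have hi : Integrable (fun x => φ (∫ y, y ∂(k x))) μ := by
    refine (hi2.norm.add ((hi1.const_mul a).add (integrable_const c)).norm).mono'
      (hc.measurable.comp measurable_barycenter).aestronglyMeasurable ?_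
    filter_upwards [hle] with x hx
    have h3 := hac (∫ y, y ∂(k x))
    simp only [Pi.add_apply, Real.norm_eq_abs]
    rw [abs_le]
    constructor
    · linarith [neg_abs_le (a * ∫ y, y ∂(k x) + c), abs_nonneg (∫ y, φ y ∂(k x)),
        neg_abs_le (a * (∫ y, y ∂(k x)) + c)]
    · linarith [le_abs_self (∫ y, φ y ∂(k x)), abs_nonneg (a * (∫ y, y ∂(k x)) + c)]
  refine ⟨hi, ?_⟩
  rw [← integral_integral_of_compProd_mem hπ hφν]
  exact integral_mono_ae hi hi2 hle

theorem convexOrderLE_map_barycenter (hπ : μ ⊗ₘ k ∈ couplings μ ν)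
    (hν : Integrable (fun y : ℝ => y) ν) [IsProbabilityMeasure ν] :
    ConvexOrderLE (μ.map fun x => ∫ y, y ∂(k x)) ν := by
  intro φ hφ _ _
  have hc := continuous_of_convexOn_univ hφ
  -- If the positive part is not integrable, the right side is `⊤`; otherwise the affine minorant
  -- makes `φ` integrable and Jensen applies.
  by_cases htop : ∫⁻ y, ENNReal.ofReal (φ y) ∂ν = ∞
  · obtain ⟨a, c, hac⟩ := exists_affine_le_of_convexOn_univ hφ
    have hneg : ∫⁻ y, ENNReal.ofReal (-φ y) ∂ν ≠ ∞ := by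
      refine ne_top_of_le_ne_top
        (((hν.const_mul a).add (integrable_const c)).neg.lintegral_lt_top.ne) ?_
      refine lintegral_mono fun y => ENNReal.ofReal_le_ofReal ?_
      simpa using neg_le_neg (hac y)
    have : extIntegral φ ν = ⊤ := by
      rw [extIntegral, htop, EReal.coe_ennreal_top, EReal.top_sub]
      exact fun h => hneg (EReal.coe_ennreal_eq_top_iff.1 h)
    rw [this]
    exact le_top
  · have hφν : Integrable φ ν := by
      obtain ⟨a, c, hac⟩ := exists_affine_le_of_convexOn_univ hφ
      have hpos : Integrable (fun y => max (φ y) 0) ν := by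
        refine ⟨(hc.max continuous_const).aestronglyMeasurable, ?_⟩
        rw [hasFiniteIntegral_iff_ofReal (f := fun y => max (φ y) 0)
          (Filter.Eventually.of_forall fun y => le_max_right _ _)]
        refine lt_of_le_of_lt (lintegral_mono fun y => ?_) (lt_top_iff_ne_top.2 htop)
        rcases le_total (φ y) 0 with h | h <;> simp [h]
      refine (hpos.add ((hν.const_mul a).add (integrable_const c)).norm).mono'
        hc.aestronglyMeasurable (Filter.Eventually.of_forall fun y => ?_)
      have h3 := hac y
      simp only [Pi.add_apply, Real.norm_eq_abs]
      rw [abs_le]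
      constructor
      · linarith [neg_abs_le (a * y + c), le_max_right (φ y) 0]
      · linarith [le_max_left (φ y) 0, abs_nonneg (a * y + c)]
    obtain ⟨h1, h2⟩ := convex_barycenter_le hπ hν hφ hφν
    have hm := (measurable_barycenter (k := k)).aemeasurable (μ := μ)
    rw [extIntegral_eq_integral hφν, extIntegral_eq_integral
      ((integrable_map_measure hc.aestronglyMeasurable hm).2 h1),
      integral_map hm hc.aestronglyMeasurable]
    exact EReal.coe_le_coe_iff.2 h2

theorem isP2_map_barycenter (hπ : μ ⊗ₘ k ∈ couplings μ ν) (hν : IsP2 ν) :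
    IsP2 (μ.map fun x => ∫ y, y ∂(k x)) := by
  have hm := (measurable_barycenter (k := k)).aemeasurable (μ := μ)
  have := Measure.isProbabilityMeasure_map hm
  refine isP2_of_integrable_sq ((integrable_map_measure (by fun_prop) hm).2 ?_)
  exact (convex_barycenter_le hπ hν.integrable_id (even_two.convexOn_pow (n := 2))
    hν.integrable_sq).1

end Barycenter

theorem compProd_quantileKernel_mem (μ ν : Measure ℝ) [IsProbabilityMeasure μ]
    [IsProbabilityMeasure ν] : μ ⊗ₘ quantileKernel μ ν ∈ couplings μ ν :=
  compProd_quantileKernel μ ν ▸ comonotoneCoupling_mem μ ν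

theorem baryMap_eq_barycenter (μ ν : Measure ℝ) :
    baryMap μ ν = fun x => ∫ y, y ∂(quantileKernel μ ν x) :=
  funext (baryMap_eq_integral_quantileKernel μ ν)

theorem isP2_map_baryMap {μ ν : Measure ℝ} (hμ : IsP2 μ) (hν : IsP2 ν) :
    IsP2 (μ.map (baryMap μ ν)) := by
  have := hμ.isProb
  have := hν.isProb
  rw [baryMap_eq_barycenter]
  exact isP2_map_barycenter (compProd_quantileKernel_mem μ ν) hν

theorem convexOrderLE_map_baryMap {μ ν : Measure ℝ} (hμ : IsP2 μ) (hν : IsP2 ν) :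
    ConvexOrderLE (μ.map (baryMap μ ν)) ν := by
  have := hμ.isProb
  have := hν.isProb
  rw [baryMap_eq_barycenter]
  exact convexOrderLE_map_barycenter (compProd_quantileKernel_mem μ ν) hν.integrable_id

theorem ae_integrable_jumpQuantile {μ ν : Measure ℝ} (hμ : IsP2 μ) (hν : IsP2 ν) :
    ∀ᵐ x ∂μ, Integrable (jumpQuantile μ ν x) uniformUnit := by
  have := hμ.isProb
  have := hν.isProb
  filter_upwards [ae_integrable_of_compProd_mem (compProd_quantileKernel_mem μ ν)
    hν.integrable_id] with x hx
  exact (integrable_map_measure measurable_id'.aestronglyMeasurable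
    (measurable_jumpQuantile_right μ ν x).aemeasurable).1 hx

theorem ae_intervalIntegrable_jumpQuantile {μ ν : Measure ℝ} (hμ : IsP2 μ) (hν : IsP2 ν) :
    ∀ᵐ x ∂μ, IntervalIntegrable (jumpQuantile μ ν x) volume 0 1 := by
  filter_upwards [ae_integrable_jumpQuantile hμ hν] with x hx
  exact (intervalIntegrable_iff_integrableOn_Ioc_of_le zero_le_one).2 hx

/-! ### The Hardy–Littlewood inequality at one level, with its equality case. -/

/-- `π`-almost surely, the second coordinate passes the level `t` when the first one passes `s`. -/
def SplitsAt (π : Measure (ℝ × ℝ)) (s t : ℝ) : Prop :=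
  ∀ᵐ p ∂π, (s < p.1 → t ≤ p.2) ∧ (p.1 ≤ s → p.2 ≤ t)

theorem measurableSet_fst_Ioi (s : ℝ) : MeasurableSet {p : ℝ × ℝ | s < p.1} :=
  measurable_fst measurableSet_Ioi

section Level

variable {μ η : Measure ℝ} {π : Measure (ℝ × ℝ)}

theorem integrable_snd_of_mem (hπ : π ∈ couplings μ η) (hη : IsP2 η) :
    Integrable (fun p : ℝ × ℝ => p.2) π :=
  integrable_comp_of_measurePreserving (measurePreserving_snd_of_mem hπ) hη.integrable_id

theorem integral_snd_of_mem (hπ : π ∈ couplings μ η) : ∫ p, p.2 ∂π = ∫ y, y ∂η :=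
  integral_comp_of_measurePreserving (measurePreserving_snd_of_mem hπ)
    measurable_id'.aestronglyMeasurable

/-- Below `t`, the event `y ≤ r` forces `x ≤ s`; from `t` on, `x ≤ s` forces `y ≤ r`. So splitting
leaves the joint distribution function at `s` no freedom beyond the marginals. -/
theorem measure_Iic_prod_of_splitsAt (hπ : π ∈ couplings μ η) {s t : ℝ} (h : SplitsAt π s t)
    (r : ℝ) : π (Iic s ×ˢ Iic r) = if r < t then η (Iic r) else μ (Iic s) := by
  split_ifs with hr
  · rw [← hπ.2, Measure.map_apply measurable_snd measurableSet_Iic]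
    refine measure_congr ?_
    filter_upwards [h] with p hp
    refine propext ⟨fun h => h.2, fun h => ⟨?_, h⟩⟩
    by_contra hs
    exact absurd (hp.1 (not_le.1 hs)) (not_le.2 (lt_of_le_of_lt h hr))
  · rw [← hπ.1, Measure.map_apply measurable_fst measurableSet_Iic]
    refine measure_congr ?_
    filter_upwards [h] with p hp
    exact propext ⟨fun h => h.1, fun h => ⟨h, (hp.2 h).trans (not_lt.1 hr)⟩⟩

variable [IsProbabilityMeasure μ]

/-- The integrand is nonnegative, and it vanishes almost surely exactly under splitting. Its
integral is the deficit in the level inequality, so both the inequality and its equality case can be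
read off. -/
theorem integral_posPart_sub_upper (hπ : π ∈ couplings μ η) (hη : IsP2 η) (s t : ℝ) :
    Integrable (fun p => max (p.2 - t) 0 - {p : ℝ × ℝ | s < p.1}.indicator (fun p => p.2 - t) p) π ∧
      ∫ p, max (p.2 - t) 0 - {p : ℝ × ℝ | s < p.1}.indicator (fun p => p.2 - t) p ∂π =
        t * μ.real (Ioi s) + ∫ y, max (y - t) 0 ∂η - ∫ p in {p : ℝ × ℝ | s < p.1}, p.2 ∂π := by
  have := isProbabilityMeasure_of_mem_couplings hπ
  have := hη.isProb
  have hm := measurableSet_fst_Ioi s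
  have h2 := integrable_snd_of_mem hπ hη
  have hp : Integrable (fun y => max (y - t) 0) η :=
    (hη.integrable_id.sub (integrable_const t)).pos_part
  have h3 := integrable_comp_of_measurePreserving (measurePreserving_snd_of_mem hπ) hp
  have h4 : Integrable (fun p : ℝ × ℝ => p.2 - t) π := h2.sub (integrable_const t)
  refine ⟨h3.sub (h4.indicator hm), ?_⟩
  have hreal : π.real {p : ℝ × ℝ | s < p.1} = μ.real (Ioi s) := by
    rw [measureReal_def, measureReal_def, ← hπ.1, Measure.map_apply measurable_fst measurableSet_Ioi]
    rfl
  rw [integral_sub h3 (h4.indicator hm), integral_indicator hm,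
    integral_sub h2.integrableOn (integrable_const t),
    integral_comp_of_measurePreserving (measurePreserving_snd_of_mem hπ) hp.aestronglyMeasurable,
    setIntegral_const, hreal, smul_eq_mul]
  ring

theorem posPart_sub_upper_nonneg (s t : ℝ) (p : ℝ × ℝ) :
    0 ≤ max (p.2 - t) 0 - {p : ℝ × ℝ | s < p.1}.indicator (fun p => p.2 - t) p := by
  by_cases h : s < p.1 <;> simp [indicator, h]

theorem upper_setIntegral_le (hπ : π ∈ couplings μ η) (hη : IsP2 η) (s t : ℝ) :
    ∫ p in {p : ℝ × ℝ | s < p.1}, p.2 ∂π ≤ t * μ.real (Ioi s) + ∫ y, max (y - t) 0 ∂η := by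
  have h := (integral_posPart_sub_upper hπ hη s t).2
  have h' : 0 ≤ ∫ p, max (p.2 - t) 0 - {p : ℝ × ℝ | s < p.1}.indicator (fun p => p.2 - t) p ∂π :=
    integral_nonneg (posPart_sub_upper_nonneg s t)
  linarith

theorem upper_setIntegral_eq_iff (hπ : π ∈ couplings μ η) (hη : IsP2 η) (s t : ℝ) :
    ∫ p in {p : ℝ × ℝ | s < p.1}, p.2 ∂π = t * μ.real (Ioi s) + ∫ y, max (y - t) 0 ∂η ↔
      SplitsAt π s t := by
  obtain ⟨hi, h⟩ := integral_posPart_sub_upper hπ hη s t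
  have h0 := integral_eq_zero_iff_of_nonneg (posPart_sub_upper_nonneg s t) hi
  rw [h, sub_eq_zero, eq_comm] at h0
  rw [h0]
  refine Filter.eventually_congr (Filter.Eventually.of_forall fun p => ?_)
  by_cases hs : s < p.1
  · simp [indicator, hs, sub_eq_zero]
  · simp [indicator, hs, not_lt.1 hs]

theorem upper_setIntegral_of_cdf_eq_zero (hπ : π ∈ couplings μ η) {s : ℝ} (hs : cdf μ s = 0) :
    ∫ p in {p : ℝ × ℝ | s < p.1}, p.2 ∂π = ∫ y, y ∂η := by
  have h0 : μ (Iic s) = 0 := by rw [← ofReal_cdf, hs, ENNReal.ofReal_zero]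
  rw [← integral_snd_of_mem hπ, ← setIntegral_univ (μ := π)]
  refine setIntegral_congr_set ?_
  have hae : ∀ᵐ p ∂π, p.1 ∉ Iic s :=
    (measurePreserving_fst_of_mem hπ).quasiMeasurePreserving.ae (measure_eq_zero_iff_ae_notMem.1 h0)
  filter_upwards [hae] with p hp
  exact propext ⟨fun _ => trivial, fun _ => not_le.1 hp⟩

theorem ae_fst_le_of_cdf_eq_one (hπ : π ∈ couplings μ η) {s : ℝ} (hs : cdf μ s = 1) :
    ∀ᵐ p ∂π, p.1 ≤ s := by
  have h1 : μ (Iic s) = 1 := by rw [← ofReal_cdf, hs, ENNReal.ofReal_one]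
  exact (measurePreserving_fst_of_mem hπ).quasiMeasurePreserving.ae
    ((mem_ae_iff_prob_eq_one measurableSet_Iic).2 h1)

theorem upper_setIntegral_of_cdf_eq_one (hπ : π ∈ couplings μ η) {s : ℝ} (hs : cdf μ s = 1) :
    ∫ p in {p : ℝ × ℝ | s < p.1}, p.2 ∂π = 0 := by
  refine setIntegral_measure_zero _ (measure_eq_zero_iff_ae_notMem.2 ?_)
  filter_upwards [ae_fst_le_of_cdf_eq_one hπ hs] with p hp
  exact not_lt.2 hp

/-- The jump level is at least `cdf μ s` for `x > s` and at most `cdf μ s` for `x ≤ s`; the quantile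
function preserves this. -/
theorem comonotoneCoupling_splitsAt (ν : Measure ℝ) {s : ℝ} (hs : cdf μ s ∈ Ioo (0 : ℝ) 1) :
    SplitsAt (comonotoneCoupling μ ν) s (quantile ν (cdf μ s)) := by
  have hS : MeasurableSet {p : ℝ × ℝ | (s < p.1 → quantile ν (cdf μ s) ≤ p.2) ∧
      (p.1 ≤ s → p.2 ≤ quantile ν (cdf μ s))} := by
    have h1 : MeasurableSet {p : ℝ × ℝ | quantile ν (cdf μ s) ≤ p.2} :=
      measurable_snd measurableSet_Ici
    have h2 : MeasurableSet {p : ℝ × ℝ | p.2 ≤ quantile ν (cdf μ s)} :=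
      measurable_snd measurableSet_Iic
    have h3 : MeasurableSet {p : ℝ × ℝ | p.1 ≤ s} := measurable_fst measurableSet_Iic
    exact ((measurableSet_fst_Ioi s).imp h1).inter (h3.imp h2)
  refine (ae_map_iff (measurable_prodMk_jumpQuantile μ ν).aemeasurable hS).2 ?_
  filter_upwards [ae_snd_mem_uniformUnit μ, ae_jumpLevel_mem_Ioo μ] with p hp hl
  exact ⟨fun h => quantile_monotoneOn ν hs hl (cdf_le_jumpLevel μ hp h),
    fun h => quantile_monotoneOn ν hl hs (jumpLevel_le_cdf μ hp h)⟩

/-- The threshold `quantile ν (cdf μ s)` is reliable only at interior levels. At level `0` or `1`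
the upper integral is the full mean or zero, whatever the coupling. -/
theorem cdf_cases (μ : Measure ℝ) (s : ℝ) :
    cdf μ s = 0 ∨ cdf μ s = 1 ∨ cdf μ s ∈ Ioo (0 : ℝ) 1 := by
  rcases (cdf_nonneg μ s).eq_or_lt with h | h
  · exact Or.inl h.symm
  rcases (cdf_le_one μ s).eq_or_lt with h' | h'
  · exact Or.inr (Or.inl h')
  · exact Or.inr (Or.inr ⟨h, h'⟩)

/-- Hardy–Littlewood inequality at a level, including monotonicity in the convex order. -/
theorem upper_setIntegral_le_comonotone {ν : Measure ℝ} (hπ : π ∈ couplings μ η) (hη : IsP2 η)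
    (hν : IsP2 ν) (hcx : ConvexOrderLE η ν) (s : ℝ) :
    ∫ p in {p : ℝ × ℝ | s < p.1}, p.2 ∂π ≤
      ∫ p in {p : ℝ × ℝ | s < p.1}, p.2 ∂(comonotoneCoupling μ ν) := by
  have := hν.isProb
  have hc := comonotoneCoupling_mem μ ν
  rcases cdf_cases μ s with h | h | h
  · rw [upper_setIntegral_of_cdf_eq_zero hπ h, upper_setIntegral_of_cdf_eq_zero hc h,
      hcx.integral_id_eq hη hν]
  · rw [upper_setIntegral_of_cdf_eq_one hπ h, upper_setIntegral_of_cdf_eq_one hc h]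
  · rw [(upper_setIntegral_eq_iff hc hν s _).2 (comonotoneCoupling_splitsAt ν h)]
    -- The threshold is the one for `ν`, although the second marginal is `η`; the convex order then
    -- compares the integrals of `(y - t)⁺`.
    refine (upper_setIntegral_le hπ hη s (quantile ν (cdf μ s))).trans ?_
    exact add_le_add_right (hcx.integral_posPart_le hη hν _) _

theorem ext_of_Iic_prod {π π' : Measure (ℝ × ℝ)} [IsProbabilityMeasure π] [IsProbabilityMeasure π']
    (h : ∀ s r, π (Iic s ×ˢ Iic r) = π' (Iic s ×ˢ Iic r)) : π = π' := by
  have hspan : IsCountablySpanning (range (Iic : ℝ → Set ℝ)) := by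
    refine ⟨fun n : ℕ => Iic (n : ℝ), fun n => mem_range_self _, ?_⟩
    refine eq_univ_of_forall fun x => ?_
    obtain ⟨n, hn⟩ := exists_nat_ge x
    exact mem_iUnion.2 ⟨n, hn⟩
  have hgen : (inferInstance : MeasurableSpace ℝ) = MeasurableSpace.generateFrom (range Iic) := by
    rw [← borel_eq_generateFrom_Iic]
    exact BorelSpace.measurable_eq
  have hprod := generateFrom_prod_eq hspan hspan
  rw [← hgen] at hprod
  refine ext_of_generate_finite _ hprod (isPiSystem_Iic.prod isPiSystem_Iic) ?_ (by simp)
  rintro _ ⟨_, ⟨s, rfl⟩, _, ⟨r, rfl⟩, rfl⟩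
  exact h s r

/-- Equality in the level inequality makes `π` split at the thresholds of the comonotone coupling,
which fixes its joint distribution function. -/
theorem eq_comonotoneCoupling_of_upper_setIntegral_eq (hπ : π ∈ couplings μ η) (hη : IsP2 η)
    (h : ∀ s, ∫ p in {p : ℝ × ℝ | s < p.1}, p.2 ∂π =
      ∫ p in {p : ℝ × ℝ | s < p.1}, p.2 ∂(comonotoneCoupling μ η)) :
    π = comonotoneCoupling μ η := by
  have := hη.isProb
  have hc := comonotoneCoupling_mem μ η
  have := isProbabilityMeasure_of_mem_couplings hπ
  have := isProbabilityMeasure_of_mem_couplings hc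
  refine ext_of_Iic_prod fun s r => ?_
  rcases cdf_cases μ s with hs | hs | hs
  · have h0 : ∀ {ρ : Measure (ℝ × ℝ)}, ρ ∈ couplings μ η → ρ (Iic s ×ˢ Iic r) = 0 := by
      intro ρ hρ
      refine measure_mono_null (t := Prod.fst ⁻¹' Iic s) (fun p hp => hp.1) ?_
      rw [← Measure.map_apply measurable_fst measurableSet_Iic, hρ.1, ← ofReal_cdf, hs,
        ENNReal.ofReal_zero]
    rw [h0 hπ, h0 hc]
  · have h1 : ∀ {ρ : Measure (ℝ × ℝ)}, ρ ∈ couplings μ η → ρ (Iic s ×ˢ Iic r) = η (Iic r) := by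
      intro ρ hρ
      rw [← hρ.2, Measure.map_apply measurable_snd measurableSet_Iic]
      refine measure_congr ?_
      filter_upwards [ae_fst_le_of_cdf_eq_one hρ hs] with p hp
      exact propext ⟨fun h => h.2, fun h => ⟨hp, h⟩⟩
    rw [h1 hπ, h1 hc]
  · have hsp := comonotoneCoupling_splitsAt η hs
    have hsp' : SplitsAt π s (quantile η (cdf μ s)) := by
      rw [← upper_setIntegral_eq_iff hπ hη, h, upper_setIntegral_eq_iff hc hη]
      exact hsp
    rw [measure_Iic_prod_of_splitsAt hπ hsp', measure_Iic_prod_of_splitsAt hc hsp]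

end Level

/-! ### Layer-cake formula for the mixed moment. -/

/-- The kernel `1_{s < x} - 1_{s < 0}`, whose integral over `s` is `x`. -/
noncomputable def layerKernel (x s : ℝ) : ℝ :=
  (if s < x then 1 else 0) - (if s < 0 then 1 else 0)

theorem layerKernel_eq (x : ℝ) :
    layerKernel x = (Ico 0 x).indicator 1 - (Ico x 0).indicator 1 := by
  ext s
  simp only [layerKernel, Pi.sub_apply, indicator, mem_Ico, Pi.one_apply]
  grind

theorem abs_layerKernel_eq (x : ℝ) :
    (fun s => |layerKernel x s|) = (Ico 0 x).indicator 1 + (Ico x 0).indicator 1 := by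
  ext s
  simp only [layerKernel, Pi.add_apply, indicator, mem_Ico, Pi.one_apply]
  grind

theorem integrable_indicator_Ico (a b : ℝ) :
    Integrable ((Ico a b).indicator (1 : ℝ → ℝ)) volume :=
  (integrable_indicator_iff measurableSet_Ico).2
    (integrableOn_const (C := (1 : ℝ)) (by simp))

theorem integral_indicator_Ico (a b : ℝ) :
    ∫ s, (Ico a b).indicator (1 : ℝ → ℝ) s = max (b - a) 0 := by
  rw [integral_indicator_one measurableSet_Ico, Real.volume_real_Ico]

theorem integrable_layerKernel (x : ℝ) : Integrable (layerKernel x) volume := by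
  rw [layerKernel_eq]
  exact (integrable_indicator_Ico _ _).sub (integrable_indicator_Ico _ _)

theorem integral_layerKernel (x : ℝ) : ∫ s, layerKernel x s = x := by
  rw [layerKernel_eq, integral_sub' (integrable_indicator_Ico _ _) (integrable_indicator_Ico _ _),
    integral_indicator_Ico, integral_indicator_Ico]
  grind

theorem integral_abs_layerKernel (x : ℝ) : ∫ s, |layerKernel x s| = |x| := by
  rw [abs_layerKernel_eq, integral_add' (integrable_indicator_Ico _ _) (integrable_indicator_Ico _ _),
    integral_indicator_Ico, integral_indicator_Ico]
  grind

theorem measurable_layerKernel : Measurable fun q : ℝ × ℝ => layerKernel q.1 q.2 := by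
  unfold layerKernel
  exact (Measurable.ite (measurableSet_lt measurable_snd measurable_fst) measurable_const
    measurable_const).sub (Measurable.ite (measurableSet_lt measurable_snd measurable_const)
    measurable_const measurable_const)

section Layer

variable {π : Measure (ℝ × ℝ)}

theorem integral_layerKernel_mul_snd (h2 : Integrable (fun p : ℝ × ℝ => p.2) π) (s : ℝ) :
    ∫ p, layerKernel p.1 s * p.2 ∂π =
      ∫ p in {p : ℝ × ℝ | s < p.1}, p.2 ∂π - if s < 0 then ∫ p, p.2 ∂π else 0 := by
  have h : (fun p : ℝ × ℝ => layerKernel p.1 s * p.2) = fun p =>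
      {p : ℝ × ℝ | s < p.1}.indicator (fun p => p.2) p - (if s < 0 then p.2 else 0) := by
    ext p
    simp only [layerKernel, indicator, mem_ofPred_eq]
    split_ifs <;> simp
  rw [h, integral_sub (h2.indicator (measurableSet_fst_Ioi s)),
    integral_indicator (measurableSet_fst_Ioi s)]
  · split_ifs <;> simp
  · split_ifs
    · exact h2
    · exact integrable_zero _ _ _

/-- Fubini applied to `x = ∫ layerKernel x s ds`; since `∫ |layerKernel x s| ds = |x|`, absolute
integrability reduces to that of `xy`. Subtracting the mean for `s < 0` is what makes the upper
integrals integrable in `s`. -/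
theorem integral_mul_eq_integral_upper [IsProbabilityMeasure π]
    (h2 : Integrable (fun p : ℝ × ℝ => p.2) π)
    (h12 : Integrable (fun p : ℝ × ℝ => p.1 * p.2) π) :
    Integrable (fun s => ∫ p in {p : ℝ × ℝ | s < p.1}, p.2 ∂π - if s < 0 then ∫ p, p.2 ∂π else 0)
      volume ∧
    ∫ p, p.1 * p.2 ∂π =
      ∫ s, (∫ p in {p : ℝ × ℝ | s < p.1}, p.2 ∂π - if s < 0 then ∫ p, p.2 ∂π else 0) := by
  have hm : Measurable fun q : (ℝ × ℝ) × ℝ => layerKernel q.1.1 q.2 * q.1.2 :=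
    (measurable_layerKernel.comp (measurable_fst.fst.prodMk measurable_snd)).mul
      measurable_fst.snd
  have hi : Integrable (Function.uncurry fun (p : ℝ × ℝ) s => layerKernel p.1 s * p.2)
      (π.prod volume) := by
    refine (integrable_prod_iff hm.aestronglyMeasurable).2 ⟨?_, ?_⟩
    · exact Filter.Eventually.of_forall fun p => (integrable_layerKernel p.1).mul_const p.2
    · refine h12.norm.congr (Filter.Eventually.of_forall fun p => ?_)
      simp only [norm_mul, Real.norm_eq_abs]
      rw [integral_mul_const, integral_abs_layerKernel]
  simp_rw [← integral_layerKernel_mul_snd h2]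
  refine ⟨hi.integral_prod_right, ?_⟩
  rw [← integral_integral_swap hi]
  refine integral_congr_ae (Filter.Eventually.of_forall fun p => ?_)
  simp only
  rw [integral_mul_const, integral_layerKernel]

/-- Right-continuity in `s`, used to pass from almost every level to every level. -/
theorem tendsto_upper_setIntegral {s : ℝ} (h2 : Integrable (fun p : ℝ × ℝ => p.2) π) {u : ℕ → ℝ}
    (hu : Antitone u) (hs : ∀ n, s < u n) (hlim : Filter.Tendsto u Filter.atTop (nhds s)) :
    Filter.Tendsto (fun n => ∫ p in {p : ℝ × ℝ | u n < p.1}, p.2 ∂π) Filter.atTop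
      (nhds (∫ p in {p : ℝ × ℝ | s < p.1}, p.2 ∂π)) := by
  have hU : (⋃ n, {p : ℝ × ℝ | u n < p.1}) = {p : ℝ × ℝ | s < p.1} := by
    ext p
    simp only [mem_iUnion, mem_ofPred_eq]
    refine ⟨fun ⟨n, hn⟩ => (hs n).trans hn, fun h => ?_⟩
    exact (hlim.eventually (gt_mem_nhds h)).exists
  rw [← hU]
  refine tendsto_setIntegral_of_monotone (fun n => measurableSet_fst_Ioi _) ?_ h2.integrableOn
  intro m n hmn p hp
  exact lt_of_le_of_lt (hu hmn) hp

end Layer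

/-! ### Optimality and uniqueness of the comonotone coupling. -/

section Cost

variable {μ η ν : Measure ℝ} {π : Measure (ℝ × ℝ)}

theorem integrable_fst_sq_of_mem (hπ : π ∈ couplings μ η) (hμ : IsP2 μ) :
    Integrable (fun p : ℝ × ℝ => p.1 ^ 2) π :=
  integrable_comp_of_measurePreserving (measurePreserving_fst_of_mem hπ) hμ.integrable_sq

theorem integrable_snd_sq_of_mem (hπ : π ∈ couplings μ η) (hη : IsP2 η) :
    Integrable (fun p : ℝ × ℝ => p.2 ^ 2) π :=
  integrable_comp_of_measurePreserving (measurePreserving_snd_of_mem hπ) hη.integrable_sq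

theorem integrable_mul_of_mem (hπ : π ∈ couplings μ η) (hμ : IsP2 μ) (hη : IsP2 η) :
    Integrable (fun p : ℝ × ℝ => p.1 * p.2) π := by
  have h1 : MemLp (fun p : ℝ × ℝ => p.1) 2 π :=
    (memLp_two_iff_integrable_sq measurable_fst.aestronglyMeasurable).2
      (integrable_fst_sq_of_mem hπ hμ)
  have h2 : MemLp (fun p : ℝ × ℝ => p.2) 2 π :=
    (memLp_two_iff_integrable_sq measurable_snd.aestronglyMeasurable).2
      (integrable_snd_sq_of_mem hπ hη)
  exact h1.integrable_mul h2

theorem isP2_of_mem_couplings (hπ : π ∈ couplings μ η) (hμ : IsP2 μ) (hη : IsP2 η) :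
    IsP2 π := by
  have := hμ.isProb
  refine ⟨isProbabilityMeasure_of_mem_couplings hπ, ?_⟩
  have h1 : MemLp (fun p : ℝ × ℝ => p.1) 2 π :=
    (memLp_two_iff_integrable_sq measurable_fst.aestronglyMeasurable).2
      (integrable_fst_sq_of_mem hπ hμ)
  have h2 : MemLp (fun p : ℝ × ℝ => p.2) 2 π :=
    (memLp_two_iff_integrable_sq measurable_snd.aestronglyMeasurable).2
      (integrable_snd_sq_of_mem hπ hη)
  refine (h1.norm.add h2.norm).mono measurable_id'.aestronglyMeasurable
    (Filter.Eventually.of_forall fun p => ?_)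
  simp only [Pi.add_apply, Prod.norm_def]
  refine le_trans ?_ (le_abs_self _)
  exact max_le_add_of_nonneg (norm_nonneg _) (norm_nonneg _)

/-- Nonnegativity is recorded because equal values of `ENNReal.ofReal` can be compared only for
nonnegative reals. -/
theorem quadCost_eq_ofReal (hπ : π ∈ couplings μ η) (hμ : IsP2 μ) (hη : IsP2 η) :
    0 ≤ ∫ x, x ^ 2 ∂μ + ∫ y, y ^ 2 ∂η - 2 * ∫ p, p.1 * p.2 ∂π ∧
    quadCost π =
      ENNReal.ofReal (∫ x, x ^ 2 ∂μ + ∫ y, y ^ 2 ∂η - 2 * ∫ p, p.1 * p.2 ∂π) := by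
  have i1 := integrable_fst_sq_of_mem hπ hμ
  have i2 := integrable_snd_sq_of_mem hπ hη
  have i3 := (integrable_mul_of_mem hπ hμ hη).const_mul 2
  have he : (fun p : ℝ × ℝ => |p.2 - p.1| ^ 2) = fun p => p.1 ^ 2 + p.2 ^ 2 - 2 * (p.1 * p.2) := by
    ext p; rw [sq_abs]; ring
  have h : ∫ p : ℝ × ℝ, |p.2 - p.1| ^ 2 ∂π =
      ∫ x, x ^ 2 ∂μ + ∫ y, y ^ 2 ∂η - 2 * ∫ p, p.1 * p.2 ∂π := by
    have hadd : Integrable (fun p : ℝ × ℝ => p.1 ^ 2 + p.2 ^ 2) π := i1.add i2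
    rw [he, integral_sub hadd i3, integral_add i1 i2, integral_const_mul,
      integral_comp_of_measurePreserving (measurePreserving_fst_of_mem hπ)
        (f := fun x => x ^ 2) hμ.integrable_sq.aestronglyMeasurable,
      integral_comp_of_measurePreserving (measurePreserving_snd_of_mem hπ)
        (f := fun x => x ^ 2) hη.integrable_sq.aestronglyMeasurable]
  rw [← h]
  have hi : Integrable (fun p : ℝ × ℝ => |p.2 - p.1| ^ 2) π := by
    rw [he]; exact (i1.add i2).sub i3
  exact ⟨integral_nonneg fun p => by positivity, (ofReal_integral_eq_lintegral_ofReal hi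
    (Filter.Eventually.of_forall fun p => by positivity)).symm⟩

/-- Integrate the level inequality over `s`; the corrections for `s < 0` agree because `η` and `ν`
have the same mean. -/
theorem integral_mul_le_comonotone (hμ : IsP2 μ) (hη : IsP2 η) (hν : IsP2 ν)
    (hcx : ConvexOrderLE η ν) (hπ : π ∈ couplings μ η) :
    ∫ p, p.1 * p.2 ∂π ≤ ∫ p, p.1 * p.2 ∂(comonotoneCoupling μ ν) := by
  have := hμ.isProb
  have := hν.isProb
  have hc := comonotoneCoupling_mem μ ν
  have := isProbabilityMeasure_of_mem_couplings hπ
  have := isProbabilityMeasure_of_mem_couplings hc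
  obtain ⟨i1, e1⟩ := integral_mul_eq_integral_upper (integrable_snd_of_mem hπ hη)
    (integrable_mul_of_mem hπ hμ hη)
  obtain ⟨i2, e2⟩ := integral_mul_eq_integral_upper (integrable_snd_of_mem hc hν)
    (integrable_mul_of_mem hc hμ hν)
  rw [e1, e2]
  refine integral_mono i1 i2 fun s => ?_
  simp only
  rw [integral_snd_of_mem hπ, integral_snd_of_mem hc, hcx.integral_id_eq hη hν]
  exact sub_le_sub_right (upper_setIntegral_le_comonotone hπ hη hν hcx s) _

theorem upper_setIntegral_eq_of_integral_mul_eq (hμ : IsP2 μ) (hη : IsP2 η) (hν : IsP2 ν)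
    (hcx : ConvexOrderLE η ν) (hπ : π ∈ couplings μ η)
    (h : ∫ p, p.1 * p.2 ∂π = ∫ p, p.1 * p.2 ∂(comonotoneCoupling μ ν)) (s : ℝ) :
    ∫ p in {p : ℝ × ℝ | s < p.1}, p.2 ∂π =
      ∫ p in {p : ℝ × ℝ | s < p.1}, p.2 ∂(comonotoneCoupling μ ν) := by
  have := hμ.isProb
  have := hν.isProb
  have hc := comonotoneCoupling_mem μ ν
  have := isProbabilityMeasure_of_mem_couplings hπ
  have := isProbabilityMeasure_of_mem_couplings hc
  obtain ⟨i1, e1⟩ := integral_mul_eq_integral_upper (integrable_snd_of_mem hπ hη)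
    (integrable_mul_of_mem hπ hμ hη)
  obtain ⟨i2, e2⟩ := integral_mul_eq_integral_upper (integrable_snd_of_mem hc hν)
    (integrable_mul_of_mem hc hμ hν)
  rw [e1, e2, integral_eq_iff_of_ae_le i1 i2 (Filter.Eventually.of_forall fun s => by
    simp only
    rw [integral_snd_of_mem hπ, integral_snd_of_mem hc, hcx.integral_id_eq hη hν]
    exact sub_le_sub_right (upper_setIntegral_le_comonotone hπ hη hν hcx s) _)] at h
  have hae : ∀ᵐ s, ∫ p in {p : ℝ × ℝ | s < p.1}, p.2 ∂π =
      ∫ p in {p : ℝ × ℝ | s < p.1}, p.2 ∂(comonotoneCoupling μ ν) := by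
    filter_upwards [h] with s hs
    rw [integral_snd_of_mem hπ, integral_snd_of_mem hc, hcx.integral_id_eq hη hν] at hs
    exact sub_left_injective hs
  -- Ordered integrands with equal integrals agree at almost every level; a sequence of such levels
  -- decreasing to `s` gives equality at `s`.
  obtain ⟨u, hu, hus, hlim⟩ := (Measure.dense_of_ae hae).exists_seq_strictAnti_tendsto s
  refine tendsto_nhds_unique (tendsto_upper_setIntegral (integrable_snd_of_mem hπ hη) hu.antitone
    (fun n => (hus n).1) hlim) ?_
  refine (tendsto_upper_setIntegral (integrable_snd_of_mem hc hν) hu.antitone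
    (fun n => (hus n).1) hlim).congr fun n => ?_
  exact ((hus n).2 : _ = _).symm

theorem eq_comonotoneCoupling_of_integral_mul_eq (hμ : IsP2 μ) (hν : IsP2 ν)
    (hπ : π ∈ couplings μ ν)
    (h : ∫ p, p.1 * p.2 ∂π = ∫ p, p.1 * p.2 ∂(comonotoneCoupling μ ν)) :
    π = comonotoneCoupling μ ν :=
  have := hμ.isProb
  eq_comonotoneCoupling_of_upper_setIntegral_eq hπ hν
    (upper_setIntegral_eq_of_integral_mul_eq hμ hν hν (convexOrderLE_refl ν) hπ h)

theorem W2sq_eq_quadCost_comonotoneCoupling (hμ : IsP2 μ) (hν : IsP2 ν) :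
    W2sq μ ν = quadCost (comonotoneCoupling μ ν) := by
  have := hμ.isProb
  have := hν.isProb
  have hc := comonotoneCoupling_mem μ ν
  refine le_antisymm (iInf₂_le _ hc) (le_iInf₂ fun π hπ => ?_)
  rw [(quadCost_eq_ofReal hc hμ hν).2, (quadCost_eq_ofReal hπ hμ hν).2]
  refine ENNReal.ofReal_le_ofReal ?_
  linarith [integral_mul_le_comonotone hμ hν hν (convexOrderLE_refl ν) hπ]

/-- The comonotone coupling is the unique optimal coupling. -/
theorem optCouplings_eq_singleton (hμ : IsP2 μ) (hν : IsP2 ν) :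
    optCouplings μ ν = {comonotoneCoupling μ ν} := by
  have := hμ.isProb
  have := hν.isProb
  have hc := comonotoneCoupling_mem μ ν
  ext π
  rw [mem_singleton_iff]
  constructor
  · rintro ⟨-, hπ, h⟩
    refine eq_comonotoneCoupling_of_integral_mul_eq hμ hν hπ ?_
    obtain ⟨n1, e1⟩ := quadCost_eq_ofReal hπ hμ hν
    obtain ⟨n2, e2⟩ := quadCost_eq_ofReal hc hμ hν
    rw [W2sq_eq_quadCost_comonotoneCoupling hμ hν, e1, e2,
      ENNReal.ofReal_eq_ofReal_iff n2 n1] at h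
    linarith
  · rintro rfl
    exact ⟨isP2_of_mem_couplings hc hμ hν, hc, W2sq_eq_quadCost_comonotoneCoupling hμ hν⟩

theorem toReal_W2sq (hμ : IsP2 μ) (hν : IsP2 ν) :
    (W2sq μ ν).toReal = ∫ x, x ^ 2 ∂μ + ∫ y, y ^ 2 ∂ν -
      2 * ∫ p, p.1 * p.2 ∂(comonotoneCoupling μ ν) := by
  have := hμ.isProb
  have := hν.isProb
  obtain ⟨n, e⟩ := quadCost_eq_ofReal (comonotoneCoupling_mem μ ν) hμ hν
  rw [W2sq_eq_quadCost_comonotoneCoupling hμ hν, e, ENNReal.toReal_ofReal n]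

end Cost

/-! ### The barycentric map and its image measure. -/

section Disintegration

variable {μ ν : Measure ℝ} [IsProbabilityMeasure μ] {k : Kernel ℝ ℝ} [IsMarkovKernel k]

theorem integral_mul_compProd (hπ : μ ⊗ₘ k ∈ couplings μ ν) (hμ : IsP2 μ) (hν : IsP2 ν) :
    ∫ p, p.1 * p.2 ∂(μ ⊗ₘ k) = ∫ x, x * ∫ y, y ∂(k x) ∂μ := by
  rw [Measure.integral_compProd (integrable_mul_of_mem hπ hμ hν)]
  exact integral_congr_ae (Filter.Eventually.of_forall fun x => integral_const_mul _ _)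

theorem setIntegral_snd_compProd (hπ : μ ⊗ₘ k ∈ couplings μ ν) (hν : IsP2 ν) {s : Set ℝ}
    (hs : MeasurableSet s) :
    ∫ p in s ×ˢ univ, p.2 ∂(μ ⊗ₘ k) = ∫ x in s, ∫ y, y ∂(k x) ∂μ := by
  rw [Measure.setIntegral_compProd hs MeasurableSet.univ
    (integrable_snd_of_mem hπ hν).integrableOn]
  simp_rw [setIntegral_univ]

theorem map_fst_compProd : (μ ⊗ₘ k).map Prod.fst = μ := Measure.fst_compProd μ k

theorem map_compProd_comap {T : ℝ → ℝ} (hT : Measurable T) :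
    (μ ⊗ₘ k.comap T hT).map (Prod.map T id) = μ.map T ⊗ₘ k := by
  have : IsProbabilityMeasure (μ.map T) := Measure.isProbabilityMeasure_map hT.aemeasurable
  have hm : Measurable (Prod.map T (id : ℝ → ℝ)) := hT.prodMap measurable_id
  ext s hs
  rw [Measure.map_apply hm hs, Measure.compProd_apply (hm hs), Measure.compProd_apply hs,
    lintegral_map (Kernel.measurable_kernel_prodMk_left hs) hT]
  rfl

end Disintegration

theorem integral_mul_comonotoneCoupling {μ ν : Measure ℝ} (hμ : IsP2 μ) (hν : IsP2 ν) :
    ∫ p, p.1 * p.2 ∂(comonotoneCoupling μ ν) = ∫ x, x * baryMap μ ν x ∂μ := by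
  have := hμ.isProb
  have := hν.isProb
  rw [← compProd_quantileKernel, integral_mul_compProd (compProd_quantileKernel_mem μ ν) hμ hν,
    baryMap_eq_barycenter]

theorem setIntegral_snd_comonotoneCoupling {μ ν : Measure ℝ} (hμ : IsP2 μ) (hν : IsP2 ν)
    {s : Set ℝ} (hs : MeasurableSet s) :
    ∫ p in s ×ˢ univ, p.2 ∂(comonotoneCoupling μ ν) = ∫ x in s, baryMap μ ν x ∂μ := by
  have := hμ.isProb
  have := hν.isProb
  rw [← compProd_quantileKernel,
    setIntegral_snd_compProd (compProd_quantileKernel_mem μ ν) hν hs, baryMap_eq_barycenter]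

/-- The optimal coupling is unique and its disintegration is a.e. unique, so the barycenters are
too. -/
theorem barySet_eq_singleton {μ ν : Measure ℝ} (hμ : IsP2 μ) (hν : IsP2 ν) :
    barySet μ ν = {μ.map (baryMap μ ν)} := by
  have := hμ.isProb
  have := hν.isProb
  ext η
  rw [mem_singleton_iff, barySet, optCouplings_eq_singleton hμ hν]
  constructor
  · rintro ⟨k, hk, hπ, rfl⟩
    rw [mem_singleton_iff, ← compProd_quantileKernel] at hπ
    refine Measure.map_congr ?_
    filter_upwards [Kernel.ae_eq_of_compProd_eq hπ] with x hx
    rw [hx, baryMap_eq_integral_quantileKernel]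
  · rintro rfl
    exact ⟨quantileKernel μ ν, inferInstance, compProd_quantileKernel μ ν,
      by rw [baryMap_eq_barycenter]⟩

section Graph

variable {μ ν : Measure ℝ}

theorem measurable_prodMk_baryMap (μ ν : Measure ℝ) :
    Measurable fun x => (x, baryMap μ ν x) :=
  measurable_id'.prodMk (measurable_baryMap μ ν)

theorem map_graph_baryMap_mem (μ ν : Measure ℝ) :
    μ.map (fun x => (x, baryMap μ ν x)) ∈ couplings μ (μ.map (baryMap μ ν)) := by
  constructor
  · rw [Measure.map_map measurable_fst (measurable_prodMk_baryMap μ ν)]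
    exact Measure.map_id
  · rw [Measure.map_map measurable_snd (measurable_prodMk_baryMap μ ν)]
    rfl

theorem integral_mul_map_graph (hμ : IsP2 μ) (hν : IsP2 ν) :
    ∫ p, p.1 * p.2 ∂(μ.map fun x => (x, baryMap μ ν x)) =
      ∫ p, p.1 * p.2 ∂(comonotoneCoupling μ ν) := by
  rw [integral_mul_comonotoneCoupling hμ hν,
    integral_map (f := fun p : ℝ × ℝ => p.1 * p.2) (measurable_prodMk_baryMap μ ν).aemeasurable
      (measurable_fst.mul measurable_snd).aestronglyMeasurable]

/-- One inequality is monotonicity in the convex order; for the other, the graph coupling already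
attains `∫ x 𝓣(x) dμ`. -/
theorem integral_mul_comonotoneCoupling_map_baryMap (hμ : IsP2 μ) (hν : IsP2 ν) :
    ∫ p, p.1 * p.2 ∂(comonotoneCoupling μ (μ.map (baryMap μ ν))) =
      ∫ p, p.1 * p.2 ∂(comonotoneCoupling μ ν) := by
  have := hμ.isProb
  have hm := isP2_map_baryMap hμ hν
  have := hm.isProb
  refine le_antisymm (integral_mul_le_comonotone hμ hm hν (convexOrderLE_map_baryMap hμ hν)
    (comonotoneCoupling_mem _ _)) ?_
  rw [← integral_mul_map_graph hμ hν]
  exact integral_mul_le_comonotone hμ hm hm (convexOrderLE_refl _) (map_graph_baryMap_mem μ ν)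

theorem optCouplings_map_baryMap (hμ : IsP2 μ) (hν : IsP2 ν) :
    optCouplings μ (μ.map (baryMap μ ν)) = {μ.map (fun x => (x, baryMap μ ν x))} := by
  have hm := isP2_map_baryMap hμ hν
  rw [optCouplings_eq_singleton hμ hm, eq_comonotoneCoupling_of_integral_mul_eq hμ hm
    (map_graph_baryMap_mem μ ν)]
  rw [integral_mul_map_graph hμ hν, integral_mul_comonotoneCoupling_map_baryMap hμ hν]

end Graph

/-! ### The convex-order interval. -/

theorem ae_eq_of_setIntegral_Ioi_eq {μ : Measure ℝ} {f g : ℝ → ℝ}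
    (hf : Integrable f μ) (hg : Integrable g μ) (htot : ∫ x, f x ∂μ = ∫ x, g x ∂μ)
    (h : ∀ s, ∫ x in Ioi s, f x ∂μ = ∫ x in Ioi s, g x ∂μ) : f =ᵐ[μ] g := by
  refine hf.ae_eq_of_forall_setIntegral_eq _ _ hg fun s hs hfin => ?_
  clear hfin
  have hgen : (inferInstance : MeasurableSpace ℝ) = MeasurableSpace.generateFrom (range Ioi) := by
    rw [← borel_eq_generateFrom_Ioi]
    exact BorelSpace.measurable_eq
  induction s, hs using MeasurableSpace.induction_on_inter hgen isPiSystem_Ioi with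
  | empty => simp
  | basic t ht =>
    obtain ⟨a, rfl⟩ := ht
    exact h a
  | compl t ht ih =>
    have h1 := integral_add_compl ht hf
    have h2 := integral_add_compl ht hg
    linarith
  | iUnion t hd ht ih =>
    rw [integral_iUnion ht hd hf.integrableOn, integral_iUnion ht hd hg.integrableOn]
    exact tsum_congr fun i => ih i

/-- The upper integrals of a comonotone coupling are the integrals of its barycentric map over
half-lines, which determine that map a.e. -/
theorem baryMap_ae_eq_of_integral_mul_eq {μ η ν : Measure ℝ} (hμ : IsP2 μ) (hη : IsP2 η)
    (hν : IsP2 ν) (hcx : ConvexOrderLE η ν)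
    (h : ∫ p, p.1 * p.2 ∂(comonotoneCoupling μ η) = ∫ p, p.1 * p.2 ∂(comonotoneCoupling μ ν)) :
    baryMap μ η =ᵐ[μ] baryMap μ ν := by
  have := hμ.isProb
  have := hη.isProb
  have := hν.isProb
  have hint : ∀ {ρ : Measure ℝ}, IsP2 ρ → Integrable (baryMap μ ρ) μ ∧
      ∫ x, baryMap μ ρ x ∂μ = ∫ y, y ∂ρ := by
    intro ρ hρ
    have := hρ.isProb
    rw [baryMap_eq_barycenter]
    exact ⟨integrable_integral_of_compProd_mem (compProd_quantileKernel_mem μ ρ)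
      hρ.integrable_id, integral_integral_of_compProd_mem (compProd_quantileKernel_mem μ ρ)
      hρ.integrable_id⟩
  refine ae_eq_of_setIntegral_Ioi_eq (hint hη).1 (hint hν).1 ?_ fun s => ?_
  · rw [(hint hη).2, (hint hν).2, hcx.integral_id_eq hη hν]
  · rw [← setIntegral_snd_comonotoneCoupling hμ hη measurableSet_Ioi,
      ← setIntegral_snd_comonotoneCoupling hμ hν measurableSet_Ioi]
    have hset : Ioi s ×ˢ (univ : Set ℝ) = {p : ℝ × ℝ | s < p.1} := by ext; simp
    rw [hset]
    exact upper_setIntegral_eq_of_integral_mul_eq hμ hη hν hcx (comonotoneCoupling_mem μ η) h s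

theorem interSet_eq {μ ν : Measure ℝ} (hμ : IsP2 μ) (hν : IsP2 ν) :
    interSet μ ν =
      {η | IsP2 η ∧ ConvexOrderLE (μ.map (baryMap μ ν)) η ∧ ConvexOrderLE η ν} := by
  have := hμ.isProb
  ext η
  simp only [interSet, mem_ofPred_eq, sq_abs]
  refine and_congr_right fun hη => ?_
  have := hη.isProb
  rw [toReal_W2sq hμ hν, toReal_W2sq hμ hη]
  constructor
  · rintro ⟨hcx, h⟩
    refine ⟨?_, hcx⟩
    rw [← Measure.map_congr (baryMap_ae_eq_of_integral_mul_eq hμ hη hν hcx (by linarith))]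
    exact convexOrderLE_map_baryMap hμ hη
  · rintro ⟨hcx, hcx'⟩
    refine ⟨hcx', ?_⟩
    have hm := isP2_map_baryMap hμ hν
    have := hm.isProb
    have h1 := integral_mul_le_comonotone hμ hm hη hcx (comonotoneCoupling_mem μ _)
    have h2 := integral_mul_le_comonotone hμ hη hν hcx' (comonotoneCoupling_mem μ η)
    rw [integral_mul_comonotoneCoupling_map_baryMap hμ hν] at h1
    linarith

/-! ### Comonotone pairs. -/

/-- The joint distribution function of a comonotone pair is the minimum of the marginal ones. -/
theorem measure_inter_of_comonotone {Ω : Type*} [MeasurableSpace Ω] {P : Measure Ω} {X Y : Ω → ℝ}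
    {S : Set Ω} (hS : S ∈ ae P) (h : ∀ ω ∈ S, ∀ ω' ∈ S, X ω < X ω' → Y ω ≤ Y ω') (s t : ℝ) :
    P {ω | X ω ≤ s ∧ Y ω ≤ t} = min (P {ω | X ω ≤ s}) (P {ω | Y ω ≤ t}) := by
  -- Such a point forces `{Y ≤ t}` into `{X ≤ s}` on `S`; without one, the inclusion is reversed.
  by_cases hex : ∃ ω ∈ S, X ω ≤ s ∧ t < Y ω
  · obtain ⟨ω, hω, hX, hY⟩ := hex
    have hsub : ∀ ω' ∈ S, Y ω' ≤ t → X ω' ≤ s := by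
      intro ω' hω' hY'
      by_contra! hX'
      linarith [h ω hω ω' hω' (hX.trans_lt hX')]
    rw [min_eq_right (measure_mono_ae (by filter_upwards [hS] with ω' hω' using hsub ω' hω'))]
    refine measure_congr ?_
    filter_upwards [hS] with ω' hω'
    exact propext ⟨fun h => h.2, fun h => ⟨hsub ω' hω' h, h⟩⟩
  · push Not at hex
    rw [min_eq_left (measure_mono_ae (by filter_upwards [hS] with ω' hω' using hex ω' hω'))]
    refine measure_congr ?_
    filter_upwards [hS] with ω' hω'
    exact propext ⟨fun h => h.1, fun h => ⟨h, hex ω' hω' h⟩⟩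

theorem map_Iic_prod_of_comonotone {μ ν : Measure ℝ} {Ω : Type*} [MeasurableSpace Ω]
    {P : Measure Ω} {X Y : Ω → ℝ} (hX : Measurable X) (hY : Measurable Y)
    (hmem : P.map (fun ω => (X ω, Y ω)) ∈ couplings μ ν)
    {S : Set Ω} (hS : S ∈ ae P) (h : ∀ ω ∈ S, ∀ ω' ∈ S, X ω < X ω' → Y ω ≤ Y ω') (s t : ℝ) :
    P.map (fun ω => (X ω, Y ω)) (Iic s ×ˢ Iic t) = min (μ (Iic s)) (ν (Iic t)) := by
  obtain ⟨h1, h2⟩ := hmem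
  rw [Measure.map_map measurable_fst (hX.prodMk hY)] at h1
  rw [Measure.map_map measurable_snd (hX.prodMk hY)] at h2
  rw [Measure.map_apply (hX.prodMk hY) (measurableSet_Iic.prod measurableSet_Iic), ← h1, ← h2,
    Measure.map_apply (measurable_fst.comp (hX.prodMk hY)) measurableSet_Iic,
    Measure.map_apply (measurable_snd.comp (hX.prodMk hY)) measurableSet_Iic]
  exact measure_inter_of_comonotone hS h s t

theorem comonotoneCoupling_eq_map_of_comonotone {μ ν : Measure ℝ} [IsProbabilityMeasure μ]
    [IsProbabilityMeasure ν] {Ω : Type*} [MeasurableSpace Ω]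
    {P : Measure Ω} {X Y : Ω → ℝ} (hX : Measurable X) (hY : Measurable Y)
    (hmem : P.map (fun ω => (X ω, Y ω)) ∈ couplings μ ν)
    {S : Set Ω} (hS : S ∈ ae P) (h : ∀ ω ∈ S, ∀ ω' ∈ S, X ω < X ω' → Y ω ≤ Y ω') :
    comonotoneCoupling μ ν = P.map (fun ω => (X ω, Y ω)) := by
  have := isProbabilityMeasure_of_mem_couplings hmem
  have := isProbabilityMeasure_of_mem_couplings (comonotoneCoupling_mem μ ν)
  refine ext_of_Iic_prod fun s t => ?_
  rw [map_Iic_prod_of_comonotone hX hY hmem hS h]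
  refine map_Iic_prod_of_comonotone measurable_fst (measurable_jumpQuantile μ ν)
    (comonotoneCoupling_mem μ ν)
    (S := {p | p.2 ∈ Ioc (0 : ℝ) 1 ∧ jumpLevel μ p.1 p.2 ∈ Ioo (0 : ℝ) 1})
    ((ae_snd_mem_uniformUnit μ).and (ae_jumpLevel_mem_Ioo μ)) ?_ s t
  rintro p ⟨hp, hp'⟩ q ⟨hq, hq'⟩ hpq
  exact quantile_monotoneOn ν hp' hq'
    ((jumpLevel_le_cdf μ hp le_rfl).trans (cdf_le_jumpLevel μ hq hpq))

/-- The hypotheses exclude points where the integral diverges or the levels leave `(0, 1)`: default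
values there could break monotonicity. -/
theorem baryMap_mono {μ ν : Measure ℝ} {x x' : ℝ}
    (hx : Integrable (jumpQuantile μ ν x) uniformUnit)
    (hx' : Integrable (jumpQuantile μ ν x') uniformUnit)
    (hl : ∀ᵐ u ∂uniformUnit, jumpLevel μ x u ∈ Ioo (0 : ℝ) 1)
    (hl' : ∀ᵐ u ∂uniformUnit, jumpLevel μ x' u ∈ Ioo (0 : ℝ) 1) (h : x < x') :
    baryMap μ ν x ≤ baryMap μ ν x' := by
  rw [baryMap, baryMap, intervalIntegral.integral_of_le zero_le_one,
    intervalIntegral.integral_of_le zero_le_one]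
  refine integral_mono_ae hx hx' ?_
  filter_upwards [hl, hl', ae_mem_uniformUnit] with u hu hu' h01
  exact quantile_monotoneOn ν hu hu'
    ((jumpLevel_le_cdf μ h01 le_rfl).trans (cdf_le_jumpLevel μ h01 h))

/-! ### The martingale coupling. -/

section Martingale

variable {μ ν : Measure ℝ}

theorem measurable_prodMap_baryMap (μ ν : Measure ℝ) :
    Measurable (Prod.map (baryMap μ ν) (id : ℝ → ℝ)) :=
  (measurable_baryMap μ ν).prodMap measurable_id

theorem map_prodMap_baryMap_mem [IsProbabilityMeasure μ] [IsProbabilityMeasure ν] :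
    (comonotoneCoupling μ ν).map (Prod.map (baryMap μ ν) id) ∈
      couplings (μ.map (baryMap μ ν)) ν := by
  have hc := comonotoneCoupling_mem μ ν
  have hm := measurable_prodMap_baryMap μ ν
  constructor
  · rw [Measure.map_map measurable_fst hm]
    have : Prod.fst ∘ Prod.map (baryMap μ ν) (id : ℝ → ℝ) = baryMap μ ν ∘ Prod.fst := rfl
    rw [this, ← Measure.map_map (measurable_baryMap μ ν) measurable_fst, hc.1]
  · rw [Measure.map_map measurable_snd hm]
    exact hc.2

theorem map_prodMap_baryMap_eq_comonotoneCoupling (hμ : IsP2 μ) (hν : IsP2 ν) :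
    (comonotoneCoupling μ ν).map (Prod.map (baryMap μ ν) id) =
      comonotoneCoupling (μ.map (baryMap μ ν)) ν := by
  have := hμ.isProb
  have := hν.isProb
  have := (isP2_map_baryMap hμ hν).isProb
  have hmem := map_prodMap_baryMap_mem (μ := μ) (ν := ν)
  have hmap : (comonotoneCoupling μ ν).map (Prod.map (baryMap μ ν) id) =
      (μ.prod uniformUnit).map fun p => (baryMap μ ν p.1, jumpQuantile μ ν p.1 p.2) := by
    rw [comonotoneCoupling, Measure.map_map (measurable_prodMap_baryMap μ ν)
      (measurable_prodMk_jumpQuantile μ ν)]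
    rfl
  rw [hmap] at hmem ⊢
  have hgood : ∀ᵐ x ∂μ, Integrable (jumpQuantile μ ν x) uniformUnit ∧
      ∀ᵐ u ∂uniformUnit, jumpLevel μ x u ∈ Ioo (0 : ℝ) 1 :=
    (ae_integrable_jumpQuantile hμ hν).and (Measure.ae_ae_of_ae_prod (ae_jumpLevel_mem_Ioo μ))
  refine (comonotoneCoupling_eq_map_of_comonotone ((measurable_baryMap μ ν).comp measurable_fst)
    (measurable_jumpQuantile μ ν) hmem
    (S := {p | (p.2 ∈ Ioc (0 : ℝ) 1 ∧ jumpLevel μ p.1 p.2 ∈ Ioo (0 : ℝ) 1) ∧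
      Integrable (jumpQuantile μ ν p.1) uniformUnit ∧
      ∀ᵐ u ∂uniformUnit, jumpLevel μ p.1 u ∈ Ioo (0 : ℝ) 1})
    (((ae_snd_mem_uniformUnit μ).and (ae_jumpLevel_mem_Ioo μ)).and
      (Measure.quasiMeasurePreserving_fst.ae hgood)) ?_).symm
  rintro p ⟨⟨hp, hp'⟩, hi, hl⟩ q ⟨⟨hq, hq'⟩, hi', hl'⟩ hpq
  -- Monotonicity of `𝓣` on good points: strict order of the images implies strict order of the
  -- points.
  have hlt : p.1 < q.1 := by
    rcases lt_trichotomy p.1 q.1 with h | h | h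
    · exact h
    · rw [Function.comp_apply, Function.comp_apply, h] at hpq
      exact absurd hpq (lt_irrefl _)
    · exact absurd hpq (not_lt.2 (baryMap_mono hi' hi hl' hl h))
  exact quantile_monotoneOn ν hp' hq'
    ((jumpLevel_le_cdf μ hp le_rfl).trans (cdf_le_jumpLevel μ hq hlt))

theorem exists_martingaleKernel (hμ : IsP2 μ) (hν : IsP2 ν) :
    ∃ k : Kernel ℝ ℝ, IsMartingaleKernel k ∧
      (comonotoneCoupling μ ν).map (Prod.map (baryMap μ ν) id) = μ.map (baryMap μ ν) ⊗ₘ k := by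
  have := hμ.isProb
  have := hν.isProb
  have hm := isP2_map_baryMap hμ hν
  have := hm.isProb
  have hT := measurable_baryMap μ ν
  have hmem := map_prodMap_baryMap_mem (μ := μ) (ν := ν)
  set π := (comonotoneCoupling μ ν).map (Prod.map (baryMap μ ν) id) with hπ
  have := isProbabilityMeasure_of_mem_couplings hmem
  set m := μ.map (baryMap μ ν) with hm_def
  have hdis : m ⊗ₘ π.condKernel = π := by
    have h := π.disintegrate π.condKernel
    rwa [show π.fst = m from hmem.1] at h
  have hmem' : m ⊗ₘ π.condKernel ∈ couplings m ν := by rwa [hdis]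
  -- Over a measurable set `s`, both sides integrate to the integral of `𝓣` over `𝓣⁻¹(s)` under `μ`.
  have hbar : (fun z => ∫ y, y ∂(π.condKernel z)) =ᵐ[m] fun z => z := by
    refine Integrable.ae_eq_of_forall_setIntegral_eq _ _
      (integrable_integral_of_compProd_mem hmem' hν.integrable_id) hm.integrable_id
      fun s hs _ => ?_
    rw [← setIntegral_snd_compProd hmem' hν hs, hdis, hπ,
      setIntegral_map (hs.prod MeasurableSet.univ) measurable_snd.aestronglyMeasurable
        (measurable_prodMap_baryMap μ ν).aemeasurable, hm_def,
      setIntegral_map hs measurable_id'.aestronglyMeasurable hT.aemeasurable,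
      ← setIntegral_snd_comonotoneCoupling hμ hν (hT hs)]
    rfl
  have hG : MeasurableSet {z | Integrable (fun y : ℝ => y) (π.condKernel z) ∧
      ∫ y, y ∂(π.condKernel z) = z} :=
    (measurableSet_kernel_integrable (f := fun _ y : ℝ => y)
      measurable_snd.stronglyMeasurable).inter
      (measurableSet_eq_fun measurable_barycenter measurable_id)
  classical
  -- The martingale property is required at every point, so Dirac masses replace the conditional
  -- kernel on the exceptional null set.
  refine ⟨Kernel.piecewise hG π.condKernel Kernel.id, ⟨inferInstance, fun z => ?_⟩, ?_⟩
  · rw [Kernel.piecewise_apply]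
    split_ifs with hz
    · exact hz
    · rw [Kernel.id_apply]
      exact ⟨integrable_dirac (by simp), integral_dirac _ _⟩
  · refine hdis.symm.trans (Measure.compProd_congr ?_)
    filter_upwards [hbar, ae_integrable_of_compProd_mem hmem' hν.integrable_id] with z h1 h2
    rw [Kernel.piecewise_apply, if_pos]
    exact ⟨h2, h1⟩

/-- The kernel `x ↦ k (𝓣 x)` lifts the coupling to one of `μ` and `ν` whose barycenter at `x` is `𝓣
x`. The lift therefore has maximal `∫ xy` and is the comonotone coupling. -/
theorem eq_map_of_mem_martingaleCouplings (hμ : IsP2 μ) (hν : IsP2 ν) {π : Measure (ℝ × ℝ)}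
    (hπ : π ∈ martingaleCouplings (μ.map (baryMap μ ν)) ν) :
    π = (comonotoneCoupling μ ν).map (Prod.map (baryMap μ ν) id) := by
  have := hμ.isProb
  obtain ⟨hmem, k, ⟨hk, hmart⟩, rfl⟩ := hπ
  have hT := measurable_baryMap μ ν
  have hlift := map_compProd_comap (μ := μ) (k := k) hT
  have hmem' : μ ⊗ₘ k.comap _ hT ∈ couplings μ ν := by
    refine ⟨map_fst_compProd, ?_⟩
    have h2 := hmem.2
    rw [← hlift, Measure.map_map measurable_snd (measurable_prodMap_baryMap μ ν)] at h2
    exact h2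
  rw [← hlift, eq_comonotoneCoupling_of_integral_mul_eq hμ hν hmem']
  rw [integral_mul_compProd hmem' hμ hν, integral_mul_comonotoneCoupling hμ hν]
  refine integral_congr_ae (Filter.Eventually.of_forall fun x => ?_)
  simp only [Kernel.comap_apply]
  rw [(hmart _).2]

theorem martingaleCouplings_eq_singleton (hμ : IsP2 μ) (hν : IsP2 ν) :
    martingaleCouplings (μ.map (baryMap μ ν)) ν =
      {comonotoneCoupling (μ.map (baryMap μ ν)) ν} := by
  have := hμ.isProb
  have := hν.isProb
  rw [← map_prodMap_baryMap_eq_comonotoneCoupling hμ hν]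
  exact eq_singleton_iff_unique_mem.2 ⟨⟨map_prodMap_baryMap_mem, exists_martingaleKernel hμ hν⟩,
    fun π hπ => eq_map_of_mem_martingaleCouplings hμ hν hπ⟩

end Martingale

theorem proposition3 (μ ν : Measure ℝ) (hμ : IsP2 μ) (hν : IsP2 ν) :
    AEMeasurable (baryMap μ ν) μ ∧
    (∀ᵐ x ∂μ, IntervalIntegrable (jumpQuantile μ ν x) volume 0 1) ∧
    barySet μ ν = {μ.map (baryMap μ ν)} ∧
    interSet μ ν =
      {η | IsP2 η ∧ ConvexOrderLE (μ.map (baryMap μ ν)) η ∧ ConvexOrderLE η ν} ∧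
    optCouplings μ (μ.map (baryMap μ ν)) = {μ.map (fun x => (x, baryMap μ ν x))} ∧
    ∃ π ∈ optCouplings (μ.map (baryMap μ ν)) ν,
      martingaleCouplings (μ.map (baryMap μ ν)) ν = {π} := by
  refine ⟨(measurable_baryMap μ ν).aemeasurable, ae_intervalIntegrable_jumpQuantile hμ hν,
    barySet_eq_singleton hμ hν, interSet_eq hμ hν, optCouplings_map_baryMap hμ hν,
    comonotoneCoupling (μ.map (baryMap μ ν)) ν, ?_, martingaleCouplings_eq_singleton hμ hν⟩
  rw [optCouplings_eq_singleton (isP2_map_baryMap hμ hν) hν]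
  exact mem_singleton _
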